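/- Let $g_{11}, g_{22}, g_{12} \in \mathbb{R}$, $\kappa \ge 0$ and $\gamma \ge 0$, and consider on $\mathbb{R}$ the coupled nonlinear Schrödinger system $$ \begin{aligned} i u_t &= -u_{xx} + \kappa v + i\gamma u - (g_{11}|u|^2 + g_{12}|v|^2)\,u,\\ i v_t &= -v_{xx} + \kappa u - i\gamma v - (g_{12}|u|^2 + g_{22}|v|^2)\,v \end{aligned} $$ for complex-valued functions $u(t,x)$, $v(t,x)$. A global solution is a pair $(u,v) \in C(\mathbb{R}, H^1(\mathbb{R}) \times H^1(\mathbb{R}))$ such that $u$ and $v$ are differentiable in $t$ with values in $H^{-1}(\mathbb{R})$ and both equations hold in $H^{-1}(\mathbb{R})$ for every $t \in \mathbb{R}$. (1) For every $(u_0,v_0) \in H^1(\mathbb{R}) \times H^1(\mathbb{R})$ there exists a unique global solution $(u,v)$ with $(u(0),v(0)) = (u_0,v_0)$. (2) The $H^1$ norm grows at most exponentially: there is a constant $a \ge 0$, depending only on $\kappa, \gamma, g_{11}, g_{22}, g_{12}$, such that for every global solution $(u,v)$ there is a constant $C$ with $$\|u(t)\|_{H^1} + \|v(t)\|_{H^1}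 \le C e^{a|t|} \qquad \text{for all } t \in \mathbb{R}.$$ -/

import Mathlib

open MeasureTheory
open scoped SchwartzMap ENNReal

noncomputable section

namespace PTNLS

/-- The complex space `L²(ℝ)`. -/
abbrev L2 : Type := Lp ℂ 2 (volume : Measure ℝ)

/-- The Sobolev space `H¹(ℝ)` of complex-valued functions, realized as the space of pairs `(f, f')`
in `L²(ℝ) × L²(ℝ)` for which `f'` is the distributional derivative of `f`, with the norm
`‖f‖²_{H¹} = ‖f‖²_{L²} + ‖f'‖²_{L²}`. The second component is determined by the first one. -/
def sobolevH1 : Submodule ℂ (WithLp 2 (L2 × L2)) where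
  carrier := {p | TemperedDistribution.derivCLM ℂ (p.fst : 𝓢'(ℝ, ℂ)) = (p.snd : 𝓢'(ℝ, ℂ))}
  zero_mem' := by
    simp [← Lp.toTemperedDistributionCLM_apply]
  add_mem' := by
    intro p q hp hq
    simp only [Set.mem_ofPred_eq, ← Lp.toTemperedDistributionCLM_apply] at hp hq ⊢
    rw [WithLp.add_fst, WithLp.add_snd, map_add, map_add, map_add, hp, hq]
  smul_mem' := by
    intro c p hp
    simp only [Set.mem_ofPred_eq, ← Lp.toTemperedDistributionCLM_apply] at hp ⊢
    rw [WithLp.smul_fst, WithLp.smul_snd, map_smul, map_smul, map_smul, hp]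

/-- `H¹(ℝ)` as a type; its inner product and norm are those inherited from `L²(ℝ) × L²(ℝ)`. -/
def H1 : Type := sobolevH1

instance : NormedAddCommGroup H1 := inferInstanceAs (NormedAddCommGroup sobolevH1)

instance : InnerProductSpace ℂ H1 := inferInstanceAs (InnerProductSpace ℂ sobolevH1)

/-- The inclusion `H¹(ℝ) → L²(ℝ)`. -/
def toL2 : H1 →L[ℂ] L2 :=
  (WithLp.fstL 2 ℂ L2 L2 ∘L sobolevH1.subtypeL : sobolevH1 →L[ℂ] L2)

/-- The distributional derivative `H¹(ℝ) → L²(ℝ)`. -/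
def dx : H1 →L[ℂ] L2 :=
  (WithLp.sndL 2 ℂ L2 L2 ∘L sobolevH1.subtypeL : sobolevH1 →L[ℂ] L2)

/-- The space `H⁻¹(ℝ)`, the dual of `H¹(ℝ)` with the dual norm. -/
abbrev HNeg1 : Type := StrongDual ℂ H1

/-- The (bilinear) embedding of `H¹(ℝ)` into `H⁻¹(ℝ)`, `f ↦ (φ ↦ ∫ f φ)`. -/
def toHNeg1 (f : H1) : HNeg1 :=
  (ContinuousLinearMap.mul ℂ ℂ).lpPairing volume 2 2 (toL2 f) ∘L toL2

theorem toHNeg1_apply (f φ : H1) : toHNeg1 f φ = ∫ x, toL2 f x * toL2 φ x := by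
  simp [toHNeg1, ContinuousLinearMap.lpPairing_eq_integral]

/-- The value at `φ` of the element `-u_xx + κ v + i γ u - (a |u|² + b |v|²) u` of `H⁻¹(ℝ)`.
All integrands are integrable, since functions in `H¹(ℝ)` are bounded and square integrable. -/
def rhs (κ γ a b : ℝ) (u v φ : H1) : ℂ :=
  (∫ x, dx u x * dx φ x)
    + (κ : ℂ) * (∫ x, toL2 v x * toL2 φ x)
    + Complex.I * (γ : ℂ) * (∫ x, toL2 u x * toL2 φ x)
    - ∫ x, ((a * ‖toL2 u x‖ ^ 2 + b * ‖toL2 v x‖ ^ 2 : ℝ) : ℂ) * toL2 u x * toL2 φ x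

/-- A function `w = (u, v) ∈ C(ℝ, H¹ × H¹)` is a global solution of the system
`i u_t = -u_xx + κ v + i γ u - (g₁₁ |u|² + g₁₂ |v|²) u`,
`i v_t = -v_xx + κ u - i γ v - (g₁₂ |u|² + g₂₂ |v|²) v`
if `u` and `v` are differentiable in time with values in `H⁻¹(ℝ)` and both equations hold
in `H⁻¹(ℝ)` at every time. -/
structure IsGlobalSolution (κ γ g₁₁ g₂₂ g₁₂ : ℝ) (w : C(ℝ, H1 × H1)) : Prop where
  eq_u : ∀ t : ℝ, ∃ ut : HNeg1, HasDerivAt (fun s => toHNeg1 (w s).1) ut t ∧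
    ∀ φ : H1, Complex.I * ut φ = rhs κ γ g₁₁ g₁₂ (w t).1 (w t).2 φ
  eq_v : ∀ t : ℝ, ∃ vt : HNeg1, HasDerivAt (fun s => toHNeg1 (w s).2) vt t ∧
    ∀ φ : H1, Complex.I * vt φ = rhs κ (-γ) g₂₂ g₁₂ (w t).2 (w t).1 φ

end PTNLS

end

/-!
In the interaction picture `z(t) = e^{-it∂ₓ²} w(t)`, with `w = (u, v)`, the system becomes an
ordinary differential equation in `H¹ × H¹` whose vector field is locally Lipschitz, because
`H¹(ℝ)` is an algebra. This gives uniqueness, and reduces global existence to an a priori bound.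

The Hamiltonian of the system without linear coupling is not conserved, but its derivative only
involves the terms in `κ` and `γ`, which are of lower order. By the Gagliardo–Nirenberg inequality
`‖f‖_∞² ≤ 2 ‖f‖ ‖f'‖`, adding the mass and a multiple of its cube makes the Hamiltonian control the
squared `H¹` norm, and the derivative of the sum is bounded by a multiple of the sum, so Grönwall's
inequality gives exponential growth. Solutions are differentiable in `H⁻¹` only, so the quartic
part of the energy is differentiated through the duality of `H⁻¹` with the algebra `H¹`, while the
quadratic parts are differentiated in the interaction picture.
-/

noncomputable section

namespace PTNLS

open Real Filter Topology Set Metric FourierTransform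
open scoped NNReal

/-- The element of `H¹` with a given underlying function and distributional derivative. -/
def H1.mk (a b : L2) (h : TemperedDistribution.derivCLM ℂ (a : 𝓢'(ℝ, ℂ)) = (b : 𝓢'(ℝ, ℂ))) : H1 :=
  (⟨WithLp.toLp 2 (a, b), h⟩ : sobolevH1)

@[simp] theorem toL2_mk (a b : L2) (h) : toL2 (H1.mk a b h) = a := rfl

@[simp] theorem dx_mk (a b : L2) (h) : dx (H1.mk a b h) = b := rfl

theorem H1.derivCLM_toL2 (f : H1) :
    TemperedDistribution.derivCLM ℂ (toL2 f : 𝓢'(ℝ, ℂ)) = (dx f : 𝓢'(ℝ, ℂ)) :=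
  (f : sobolevH1).2

theorem H1.ext' {f g : H1} (h₁ : toL2 f = toL2 g) (h₂ : dx f = dx g) : f = g :=
  Subtype.ext ((WithLp.equiv 2 (L2 × L2)).injective (Prod.ext h₁ h₂))

theorem L2.ext_distribution {a b : L2} (h : (a : 𝓢'(ℝ, ℂ)) = (b : 𝓢'(ℝ, ℂ))) : a = b :=
  LinearMap.ker_eq_bot.1
    (Lp.ker_toTemperedDistributionCLM_eq_bot (E := ℝ) (F := ℂ) (μ := volume) (p := 2)) h

theorem toL2_injective : Function.Injective toL2 := fun f g h =>
  H1.ext' h (L2.ext_distribution (by rw [← H1.derivCLM_toL2, ← H1.derivCLM_toL2, h]))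

theorem H1.ext_ae {f g : H1} (h : toL2 f =ᵐ[volume] toL2 g) : f = g :=
  toL2_injective (Lp.ext h)

theorem H1.inner_eq (f g : H1) :
    inner ℂ f g = inner ℂ (toL2 f) (toL2 g) + inner ℂ (dx f) (dx g) :=
  WithLp.prod_inner_apply (𝕜 := ℂ) (E := L2) (F := L2) _ _

theorem H1.norm_sq_eq (f : H1) : ‖f‖ ^ 2 = ‖toL2 f‖ ^ 2 + ‖dx f‖ ^ 2 :=
  WithLp.prod_norm_sq_eq_of_L2 (f : sobolevH1).1

theorem norm_toL2_le (f : H1) : ‖toL2 f‖ ≤ ‖f‖ :=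
  le_of_sq_le_sq (by nlinarith [f.norm_sq_eq]) (norm_nonneg f)

theorem norm_dx_le (f : H1) : ‖dx f‖ ≤ ‖f‖ :=
  le_of_sq_le_sq (by nlinarith [f.norm_sq_eq]) (norm_nonneg f)

theorem H1.norm_le_add (f : H1) : ‖f‖ ≤ ‖toL2 f‖ + ‖dx f‖ :=
  le_of_sq_le_sq
    (by nlinarith [f.norm_sq_eq, mul_nonneg (norm_nonneg (toL2 f)) (norm_nonneg (dx f))])
    (by positivity)

theorem isClosed_setOf_derivCLM_eq {X : Type*} [TopologicalSpace X] {a b : X → L2}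
    (ha : Continuous a) (hb : Continuous b) :
    IsClosed {x | TemperedDistribution.derivCLM ℂ (a x : 𝓢'(ℝ, ℂ)) = (b x : 𝓢'(ℝ, ℂ))} := by
  simp_rw [← Lp.toTemperedDistributionCLM_apply]
  apply isClosed_eq <;> fun_prop

theorem isClosed_sobolevH1 : IsClosed (sobolevH1 : Set (WithLp 2 (L2 × L2))) :=
  isClosed_setOf_derivCLM_eq (WithLp.fstL 2 ℂ L2 L2).continuous (WithLp.sndL 2 ℂ L2 L2).continuous

instance : CompleteSpace H1 :=
  haveI : IsClosed (sobolevH1 : Set (WithLp 2 (L2 × L2))) := isClosed_sobolevH1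
  inferInstanceAs (CompleteSpace sobolevH1)

/-- The inclusion of the Schwartz space into `H¹`. -/
def H1.ofSchwartz : 𝓢(ℝ, ℂ) →ₗ[ℂ] H1 where
  toFun φ := H1.mk (φ.toLp 2) ((SchwartzMap.derivCLM ℂ ℂ φ).toLp 2) (by
    rw [Lp.toTemperedDistribution_toLp_eq, Lp.toTemperedDistribution_toLp_eq,
      TemperedDistribution.derivCLM_toTemperedDistributionCLM_eq ℂ])
  map_add' φ ψ := toL2_injective <| by
    rw [map_add toL2]
    exact map_add (SchwartzMap.toLpCLM ℂ ℂ 2 volume) φ ψ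
  map_smul' c φ := toL2_injective <| by
    rw [map_smul toL2]
    exact map_smul (SchwartzMap.toLpCLM ℂ ℂ 2 volume) c φ

theorem toL2_ofSchwartz (φ : 𝓢(ℝ, ℂ)) : toL2 (H1.ofSchwartz φ) = φ.toLp 2 := rfl

theorem dx_ofSchwartz (φ : 𝓢(ℝ, ℂ)) :
    dx (H1.ofSchwartz φ) = (SchwartzMap.derivCLM ℂ ℂ φ).toLp 2 := rfl

theorem derivCLM_eq_lineDerivOp (T : 𝓢'(ℝ, ℂ)) :
    TemperedDistribution.derivCLM ℂ T = LineDeriv.lineDerivOp (1 : ℝ) T := by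
  ext φ
  rw [TemperedDistribution.derivCLM_apply_apply, TemperedDistribution.lineDerivOp_apply_apply]
  rfl

theorem fourier_derivCLM_apply (T : 𝓢'(ℝ, ℂ)) (φ : 𝓢(ℝ, ℂ)) :
    𝓕 (TemperedDistribution.derivCLM ℂ T) φ
      = 𝓕 T (SchwartzMap.smulLeftCLM ℂ (fun ξ : ℝ => 2 * π * Complex.I * ξ) φ) := by
  have hgrowth : (fun ξ : ℝ => ((inner ℝ ξ (1 : ℝ) : ℝ) : ℂ)).HasTemperateGrowth := by fun_prop
  have : (inner ℝ · (1 : ℝ) : ℝ → ℝ).HasTemperateGrowth := by fun_prop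
  have hsymbol : (fun ξ : ℝ => (2 * π * Complex.I * ξ : ℂ))
      = (2 * π * Complex.I : ℂ) • (fun ξ : ℝ => ((inner ℝ ξ (1 : ℝ) : ℝ) : ℂ)) := by
    ext ξ; simp
  rw [derivCLM_eq_lineDerivOp, TemperedDistribution.fourier_lineDerivOp_eq, hsymbol,
    SchwartzMap.smulLeftCLM_smul hgrowth]
  simp

theorem L2.fourier_toTemperedDistribution_apply (a : L2) (φ : 𝓢(ℝ, ℂ)) :
    𝓕 (a : 𝓢'(ℝ, ℂ)) φ = ∫ ξ, φ ξ * (𝓕 a : L2) ξ := by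
  rw [Lp.fourier_toTemperedDistribution_eq, Lp.toTemperedDistribution_apply]
  rfl

theorem L2.fourier_derivCLM_apply (a : L2) (φ : 𝓢(ℝ, ℂ)) :
    𝓕 (TemperedDistribution.derivCLM ℂ (a : 𝓢'(ℝ, ℂ))) φ
      = ∫ ξ, φ ξ * (2 * π * Complex.I * ξ * (𝓕 a : L2) ξ) := by
  rw [PTNLS.fourier_derivCLM_apply, L2.fourier_toTemperedDistribution_apply]
  congr 1 with ξ
  rw [SchwartzMap.smulLeftCLM_apply_apply (by fun_prop), smul_eq_mul]
  ring

theorem ae_eq_of_forall_integral_schwartz_mul_eq {f g : ℝ → ℂ} (hf : LocallyIntegrable f)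
    (hg : LocallyIntegrable g) (h : ∀ φ : 𝓢(ℝ, ℂ), ∫ x, φ x * f x = ∫ x, φ x * g x) :
    f =ᵐ[volume] g := by
  refine ae_eq_of_integral_contDiff_smul_eq hf hg fun φ φ_smooth φ_cpt => ?_
  have hcpt : HasCompactSupport (Complex.ofRealCLM ∘ φ) := φ_cpt.comp_left rfl
  simpa using h (hcpt.toSchwartzMap (Complex.ofRealCLM.contDiff.comp φ_smooth))

theorem L2.derivCLM_eq_iff_fourier (a b : L2) :
    TemperedDistribution.derivCLM ℂ (a : 𝓢'(ℝ, ℂ)) = (b : 𝓢'(ℝ, ℂ)) ↔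
      ∀ᵐ ξ : ℝ, (𝓕 b : L2) ξ = 2 * π * Complex.I * ξ * (𝓕 a : L2) ξ := by
  have hloc (c : L2) : LocallyIntegrable c volume := (Lp.memLp c).locallyIntegrable (by norm_num)
  constructor
  · intro h
    refine ae_eq_of_forall_integral_schwartz_mul_eq (hloc _)
      ((hloc _).continuous_smul (by fun_prop : Continuous fun ξ : ℝ => 2 * π * Complex.I * ξ))
      fun φ => ?_
    rw [← L2.fourier_toTemperedDistribution_apply, ← h]
    exact L2.fourier_derivCLM_apply a φ
  · intro h
    have hfourier : 𝓕 (TemperedDistribution.derivCLM ℂ (a : 𝓢'(ℝ, ℂ))) = 𝓕 (b : 𝓢'(ℝ, ℂ)) := by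
      ext φ
      rw [L2.fourier_derivCLM_apply, L2.fourier_toTemperedDistribution_apply]
      exact integral_congr_ae (by filter_upwards [h] with ξ hξ; rw [hξ])
    simpa using congrArg (fun T : 𝓢'(ℝ, ℂ) => 𝓕⁻ T) hfourier

theorem fourier_dx (f : H1) :
    ∀ᵐ ξ : ℝ, (𝓕 (dx f) : L2) ξ = 2 * π * Complex.I * ξ * (𝓕 (toL2 f) : L2) ξ :=
  (L2.derivCLM_eq_iff_fourier _ _).1 f.derivCLM_toL2

/-- Complex conjugation on the Schwartz space. -/
def conjSchwartz : 𝓢(ℝ, ℂ) →L[ℝ] 𝓢(ℝ, ℂ) :=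
  SchwartzMap.postcompCLM (Complex.conjCLE : ℂ →L[ℝ] ℂ)

theorem conjSchwartz_apply (φ : 𝓢(ℝ, ℂ)) (x : ℝ) : conjSchwartz φ x = star (φ x) := rfl

theorem derivCLM_conjSchwartz (φ : 𝓢(ℝ, ℂ)) :
    SchwartzMap.derivCLM ℂ ℂ (conjSchwartz φ) = conjSchwartz (SchwartzMap.derivCLM ℂ ℂ φ) := by
  ext x
  exact (φ.hasDerivAt x).star.deriv

theorem inner_toLp_conjSchwartz (φ : 𝓢(ℝ, ℂ)) (a : L2) :
    inner ℂ ((conjSchwartz φ).toLp 2) a = (a : 𝓢'(ℝ, ℂ)) φ := by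
  rw [L2.inner_def, Lp.toTemperedDistribution_apply]
  apply integral_congr_ae
  filter_upwards [(conjSchwartz φ).coeFn_toLp 2 volume] with x hx
  simp [hx, conjSchwartz_apply, mul_comm]

theorem derivCLM_dx_of_orthogonal_schwartz {f : H1}
    (hf : ∀ φ, inner ℂ (H1.ofSchwartz φ) f = 0) :
    TemperedDistribution.derivCLM ℂ (dx f : 𝓢'(ℝ, ℂ)) = (toL2 f : 𝓢'(ℝ, ℂ)) := by
  ext φ
  have h := hf (conjSchwartz φ)
  rw [H1.inner_eq, toL2_ofSchwartz, dx_ofSchwartz, derivCLM_conjSchwartz, inner_toLp_conjSchwartz,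
    inner_toLp_conjSchwartz] at h
  rw [TemperedDistribution.derivCLM_apply_apply, eq_neg_of_add_eq_zero_left h, map_neg]

/-- On the Fourier side, `f'' = f` reads `(1 + 4π²ξ²) 𝓕 f = 0`. -/
theorem H1.eq_zero_of_derivCLM_dx_eq {f : H1}
    (hf : TemperedDistribution.derivCLM ℂ (dx f : 𝓢'(ℝ, ℂ)) = (toL2 f : 𝓢'(ℝ, ℂ))) : f = 0 := by
  have hfourier : 𝓕 (toL2 f) = 0 := by
    apply Lp.ext
    filter_upwards [(L2.derivCLM_eq_iff_fourier _ _).1 hf, fourier_dx f,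
      Lp.coeFn_zero ℂ 2 (volume : Measure ℝ)] with ξ hdx hf' hzero
    have hprod : ((1 + 4 * π ^ 2 * ξ ^ 2 : ℝ) : ℂ) * (𝓕 (toL2 f) : L2) ξ = 0 := by
      rw [hf'] at hdx
      push_cast
      linear_combination hdx + 4 * π ^ 2 * ξ ^ 2 * (𝓕 (toL2 f) : L2) ξ * Complex.I_sq
    have hpos : (1 + 4 * π ^ 2 * ξ ^ 2 : ℝ) ≠ 0 := by positivity
    rw [hzero]
    exact (mul_eq_zero.1 hprod).resolve_left (by exact_mod_cast hpos)
  have hL2 : toL2 f = 0 := by rw [← norm_eq_zero, ← Lp.norm_fourier_eq, hfourier, norm_zero]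
  exact toL2_injective (hL2.trans (map_zero _).symm)

theorem denseRange_ofSchwartz : DenseRange H1.ofSchwartz := by
  have horth : H1.ofSchwartz.rangeᗮ = ⊥ := by
    refine (Submodule.eq_bot_iff _).2 fun f hf => ?_
    exact H1.eq_zero_of_derivCLM_dx_eq (derivCLM_dx_of_orthogonal_schwartz fun φ =>
      Submodule.inner_right_of_mem_orthogonal (LinearMap.mem_range_self _ φ) hf)
  exact Submodule.dense_iff_topologicalClosure_eq_top.2
    ((Submodule.topologicalClosure_eq_top_iff).2 horth)

section Lp

variable {α E F : Type*} [MeasurableSpace α] {μ : Measure α} [NormedAddCommGroup E]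
  [NormedAddCommGroup F]

theorem integrable_norm_mul_norm (a : Lp E 2 μ) (b : Lp F 2 μ) :
    Integrable (fun x => ‖a x‖ * ‖b x‖) μ :=
  (Lp.memLp a).norm.integrable_mul (Lp.memLp b).norm

theorem integral_norm_mul_norm_le (a : Lp E 2 μ) (b : Lp F 2 μ) :
    ∫ x, ‖a x‖ * ‖b x‖ ∂μ ≤ ‖a‖ * ‖b‖ := by
  let a' : Lp ℝ 2 μ := (Lp.memLp a).norm.toLp
  let b' : Lp ℝ 2 μ := (Lp.memLp b).norm.toLp
  have ha : ‖a'‖ = ‖a‖ := by rw [Lp.norm_toLp, eLpNorm_norm, Lp.norm_def]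
  have hb : ‖b'‖ = ‖b‖ := by rw [Lp.norm_toLp, eLpNorm_norm, Lp.norm_def]
  have h := real_inner_le_norm a' b'
  rw [L2.inner_def, ha, hb] at h
  refine le_of_eq_of_le (integral_congr_ae ?_) h
  filter_upwards [(Lp.memLp a).norm.coeFn_toLp, (Lp.memLp b).norm.coeFn_toLp] with x hax hbx
  simp only [a', b', hax, hbx, RCLike.inner_apply, conj_trivial, mul_comm]

end Lp

theorem norm_sq_le_two_mul_integral_norm_mul_norm {E : Type*} [NormedAddCommGroup E]
    [InnerProductSpace ℝ E] {f f' : ℝ → E} (hderiv : ∀ y, HasDerivAt f (f' y) y)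
    (hf' : AEStronglyMeasurable f') (hint : Integrable fun y => ‖f y‖ * ‖f' y‖)
    (hlim : Tendsto f atBot (𝓝 0)) (x : ℝ) :
    ‖f x‖ ^ 2 ≤ 2 * ∫ y, ‖f y‖ * ‖f' y‖ := by
  have hf : Continuous f := continuous_iff_continuousAt.2 fun y => (hderiv y).continuousAt
  have hderiv_sq (y : ℝ) : HasDerivAt (fun y => ‖f y‖ ^ 2) (2 * inner ℝ (f y) (f' y)) y :=
    (hderiv y).norm_sq
  have hbound (y : ℝ) : ‖2 * inner ℝ (f y) (f' y)‖ ≤ 2 * (‖f y‖ * ‖f' y‖) := by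
    rw [norm_mul, Real.norm_ofNat]
    gcongr
    exact norm_inner_le_norm _ _
  have hint' : Integrable fun y => 2 * inner ℝ (f y) (f' y) :=
    (hint.const_mul 2).mono' ((hf.aestronglyMeasurable.inner hf').const_mul 2)
      (Eventually.of_forall hbound)
  have hlim_sq : Tendsto (fun y => ‖f y‖ ^ 2) atBot (𝓝 0) := by simpa using hlim.norm.pow 2
  calc ‖f x‖ ^ 2 = ∫ y in Set.Iic x, 2 * inner ℝ (f y) (f' y) := by
        rw [integral_Iic_of_hasDerivAt_of_tendsto (hderiv_sq x).continuousAt.continuousWithinAt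
          (fun y _ => hderiv_sq y) hint'.integrableOn hlim_sq, sub_zero]
    _ ≤ ∫ y in Set.Iic x, 2 * (‖f y‖ * ‖f' y‖) :=
        integral_mono hint'.integrableOn (hint.const_mul 2).integrableOn
          fun y => (le_abs_self _).trans (hbound y)
    _ ≤ ∫ y, 2 * (‖f y‖ * ‖f' y‖) :=
        setIntegral_le_integral (hint.const_mul 2) (Eventually.of_forall fun y => by positivity)
    _ = 2 * ∫ y, ‖f y‖ * ‖f' y‖ := integral_const_mul 2 _

theorem norm_sq_le_of_schwartz (φ : 𝓢(ℝ, ℂ)) (x : ℝ) :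
    ‖φ x‖ ^ 2 ≤ 2 * ‖toL2 (H1.ofSchwartz φ)‖ * ‖dx (H1.ofSchwartz φ)‖ := by
  have hae : (fun y => ‖toL2 (H1.ofSchwartz φ) y‖ * ‖dx (H1.ofSchwartz φ) y‖)
      =ᵐ[volume] fun y => ‖φ y‖ * ‖SchwartzMap.derivCLM ℂ ℂ φ y‖ := by
    filter_upwards [φ.coeFn_toLp 2 volume, (SchwartzMap.derivCLM ℂ ℂ φ).coeFn_toLp 2 volume]
      with y hφ hφ'
    rw [toL2_ofSchwartz, dx_ofSchwartz, hφ, hφ']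
  have hlim : Tendsto φ atBot (𝓝 0) :=
    φ.toZeroAtInfty.zero_at_infty'.mono_left (atBot_le_cocompact (α := ℝ))
  calc ‖φ x‖ ^ 2 ≤ 2 * ∫ y, ‖φ y‖ * ‖SchwartzMap.derivCLM ℂ ℂ φ y‖ :=
        norm_sq_le_two_mul_integral_norm_mul_norm φ.hasDerivAt
          (SchwartzMap.derivCLM ℂ ℂ φ).continuous.aestronglyMeasurable
          ((integrable_norm_mul_norm _ _).congr hae) hlim x
    _ = 2 * ∫ y, ‖toL2 (H1.ofSchwartz φ) y‖ * ‖dx (H1.ofSchwartz φ) y‖ := by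
        rw [integral_congr_ae hae]
    _ ≤ 2 * ‖toL2 (H1.ofSchwartz φ)‖ * ‖dx (H1.ofSchwartz φ)‖ := by
        rw [mul_assoc]
        gcongr
        exact integral_norm_mul_norm_le _ _

theorem H1.exists_schwartz_seq_tendsto (f : H1) : ∃ φ : ℕ → 𝓢(ℝ, ℂ),
    Tendsto (fun n => H1.ofSchwartz (φ n)) atTop (𝓝 f) ∧
    ∀ᵐ x, Tendsto (fun n => φ n x) atTop (𝓝 (toL2 f x)) := by
  obtain ⟨u, hu, hlim⟩ := mem_closure_iff_seq_limit.1 (denseRange_ofSchwartz f)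
  choose φ hφ using hu
  obtain rfl : (fun n => H1.ofSchwartz (φ n)) = u := funext hφ
  have hlimL2 : Tendsto (fun n => toL2 (H1.ofSchwartz (φ n))) atTop (𝓝 (toL2 f)) :=
    (toL2.continuous.tendsto f).comp hlim
  obtain ⟨ns, hns, hae⟩ := (tendstoInMeasure_of_tendsto_Lp hlimL2).exists_seq_tendsto_ae
  refine ⟨fun n => φ (ns n), hlim.comp hns.tendsto_atTop, ?_⟩
  filter_upwards [hae, ae_all_iff.2 fun n => (φ (ns n)).coeFn_toLp 2 volume] with x hx hφx
  simpa only [toL2_ofSchwartz, hφx] using hx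

theorem H1.ae_norm_le_sqrt (f : H1) : ∀ᵐ x, ‖toL2 f x‖ ≤ √(2 * ‖toL2 f‖ * ‖dx f‖) := by
  obtain ⟨φ, hφ, hae⟩ := f.exists_schwartz_seq_tendsto
  filter_upwards [hae] with x hx
  refine Real.le_sqrt_of_sq_le (le_of_tendsto_of_tendsto' (hx.norm.pow 2) ?_
    fun n => norm_sq_le_of_schwartz (φ n) x)
  exact (((toL2.continuous.tendsto f).comp hφ).norm.const_mul 2).mul
    ((dx.continuous.tendsto f).comp hφ).norm

theorem H1.memLp_top (f : H1) : MemLp (toL2 f) ∞ volume :=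
  memLp_top_of_bound (Lp.aestronglyMeasurable _) _ f.ae_norm_le_sqrt

theorem H1.norm_toLp_top_le (f : H1) : ‖f.memLp_top.toLp‖ ≤ √(2 * ‖toL2 f‖ * ‖dx f‖) := by
  rw [Lp.norm_toLp]
  refine ENNReal.toReal_le_of_le_ofReal (Real.sqrt_nonneg _) ?_
  rw [eLpNorm_exponent_top]
  exact eLpNormEssSup_le_of_ae_bound f.ae_norm_le_sqrt

/-- The Sobolev embedding `H¹ → L^∞`. -/
def toLinf : H1 →L[ℂ] Lp ℂ ∞ (volume : Measure ℝ) :=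
  LinearMap.mkContinuous
    { toFun := fun f => f.memLp_top.toLp
      map_add' := fun f g => by
        rw [← MemLp.toLp_add]
        exact MemLp.toLp_congr _ _ (by rw [map_add]; exact Lp.coeFn_add _ _)
      map_smul' := fun c f => by
        rw [RingHom.id_apply, ← MemLp.toLp_const_smul]
        exact MemLp.toLp_congr _ _ (by rw [map_smul]; exact Lp.coeFn_smul _ _) }
    1 fun f => by
      refine f.norm_toLp_top_le.trans ?_
      rw [one_mul]
      apply Real.sqrt_le_iff.2 ⟨norm_nonneg _, ?_⟩
      rw [H1.norm_sq_eq]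
      nlinarith [sq_nonneg (‖toL2 f‖ - ‖dx f‖)]

theorem coeFn_toLinf (f : H1) : toLinf f =ᵐ[volume] toL2 f := f.memLp_top.coeFn_toLp

theorem norm_toLinf_sq_le (f : H1) : ‖toLinf f‖ ^ 2 ≤ 2 * ‖toL2 f‖ * ‖dx f‖ :=
  (Real.le_sqrt (norm_nonneg _) (by positivity)).1 f.norm_toLp_top_le

theorem norm_toLinf_le (f : H1) : ‖toLinf f‖ ≤ ‖f‖ := by
  simpa using toLinf.le_of_opNorm_le (LinearMap.mkContinuous_norm_le _ zero_le_one _) f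

/-- Multiplication `L^∞ × L² → L²`. -/
def mulLinf : Lp ℂ ∞ (volume : Measure ℝ) →L[ℂ] L2 →L[ℂ] L2 :=
  (ContinuousLinearMap.mul ℂ ℂ).holderL volume ∞ 2 2

theorem coeFn_mulLinf (m : Lp ℂ ∞ (volume : Measure ℝ)) (a : L2) :
    mulLinf m a =ᵐ[volume] fun x => m x * a x :=
  (ContinuousLinearMap.mul ℂ ℂ).coeFn_holder (r := 2) m a

theorem norm_mulLinf_le (m : Lp ℂ ∞ (volume : Measure ℝ)) (a : L2) :
    ‖mulLinf m a‖ ≤ ‖m‖ * ‖a‖ := by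
  have h := (ContinuousLinearMap.mul ℂ ℂ).norm_holder_apply_apply_le (r := 2) m a
  rwa [ContinuousLinearMap.opNorm_mul, one_mul] at h

/-- The product of two Schwartz functions. -/
def mulSchwartz (φ ψ : 𝓢(ℝ, ℂ)) : 𝓢(ℝ, ℂ) :=
  SchwartzMap.pairing (ContinuousLinearMap.mul ℂ ℂ) φ ψ

theorem mulSchwartz_apply (φ ψ : 𝓢(ℝ, ℂ)) (x : ℝ) : mulSchwartz φ ψ x = φ x * ψ x := rfl

theorem derivCLM_mulSchwartz (φ ψ : 𝓢(ℝ, ℂ)) :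
    SchwartzMap.derivCLM ℂ ℂ (mulSchwartz φ ψ)
      = mulSchwartz φ (SchwartzMap.derivCLM ℂ ℂ ψ)
        + mulSchwartz ψ (SchwartzMap.derivCLM ℂ ℂ φ) := by
  ext x
  refine ((φ.hasDerivAt x).fun_mul (ψ.hasDerivAt x)).deriv.trans ?_
  simp only [add_apply, mulSchwartz_apply, SchwartzMap.derivCLM_apply]
  ring

theorem mulLinf_toLinf_ofSchwartz (φ ψ : 𝓢(ℝ, ℂ)) :
    mulLinf (toLinf (H1.ofSchwartz φ)) (ψ.toLp 2) = (mulSchwartz φ ψ).toLp 2 := by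
  apply Lp.ext
  filter_upwards [coeFn_mulLinf (toLinf (H1.ofSchwartz φ)) (ψ.toLp 2),
    coeFn_toLinf (H1.ofSchwartz φ), φ.coeFn_toLp 2 volume, ψ.coeFn_toLp 2 volume,
    (mulSchwartz φ ψ).coeFn_toLp 2 volume] with x hprod hφ hφ' hψ hφψ
  rw [hprod, hφ, toL2_ofSchwartz, hφ', hψ, hφψ, mulSchwartz_apply]

theorem derivCLM_mulLinf (f g : H1) :
    TemperedDistribution.derivCLM ℂ ((mulLinf (toLinf f) (toL2 g) : L2) : 𝓢'(ℝ, ℂ))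
      = ((mulLinf (toLinf f) (dx g) + mulLinf (toLinf g) (dx f) : L2) : 𝓢'(ℝ, ℂ)) := by
  refine denseRange_ofSchwartz.induction_on₂ (p := fun f g : H1 =>
    TemperedDistribution.derivCLM ℂ ((mulLinf (toLinf f) (toL2 g) : L2) : 𝓢'(ℝ, ℂ))
      = ((mulLinf (toLinf f) (dx g) + mulLinf (toLinf g) (dx f) : L2) : 𝓢'(ℝ, ℂ)))
    (isClosed_setOf_derivCLM_eq (X := H1 × H1) (by fun_prop) (by fun_prop)) (fun φ ψ => ?_) f g
  rw [toL2_ofSchwartz, dx_ofSchwartz, dx_ofSchwartz, mulLinf_toLinf_ofSchwartz,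
    mulLinf_toLinf_ofSchwartz, mulLinf_toLinf_ofSchwartz]
  refine (H1.ofSchwartz (mulSchwartz φ ψ)).derivCLM_toL2.trans ?_
  rw [dx_ofSchwartz, derivCLM_mulSchwartz]
  exact congrArg _ <| map_add (SchwartzMap.toLpCLM ℂ ℂ 2 volume) _ _

theorem H1.norm_mk_mulLinf_le (f g : H1) :
    ‖H1.mk _ _ (derivCLM_mulLinf f g)‖ ≤ 3 * ‖f‖ * ‖g‖ := by
  have hf_g : ‖mulLinf (toLinf f) (toL2 g)‖ ≤ ‖f‖ * ‖g‖ :=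
    (norm_mulLinf_le _ _).trans
      (mul_le_mul (norm_toLinf_le f) (norm_toL2_le g) (norm_nonneg _) (norm_nonneg _))
  have hf_dg : ‖mulLinf (toLinf f) (dx g)‖ ≤ ‖f‖ * ‖g‖ :=
    (norm_mulLinf_le _ _).trans
      (mul_le_mul (norm_toLinf_le f) (norm_dx_le g) (norm_nonneg _) (norm_nonneg _))
  have hg_df : ‖mulLinf (toLinf g) (dx f)‖ ≤ ‖g‖ * ‖f‖ :=
    (norm_mulLinf_le _ _).trans
      (mul_le_mul (norm_toLinf_le g) (norm_dx_le f) (norm_nonneg _) (norm_nonneg _))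
  calc ‖H1.mk _ _ (derivCLM_mulLinf f g)‖
      ≤ ‖mulLinf (toLinf f) (toL2 g)‖
          + ‖mulLinf (toLinf f) (dx g) + mulLinf (toLinf g) (dx f)‖ := H1.norm_le_add _
    _ ≤ ‖f‖ * ‖g‖ + (‖f‖ * ‖g‖ + ‖g‖ * ‖f‖) :=
        add_le_add hf_g (norm_add_le_of_le hf_dg hg_df)
    _ = 3 * ‖f‖ * ‖g‖ := by ring

/-- Multiplication in `H¹` as a continuous bilinear map. -/
def mulCLM : H1 →L[ℂ] H1 →L[ℂ] H1 :=
  LinearMap.mkContinuous₂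
    (LinearMap.mk₂ ℂ (fun f g => H1.mk _ _ (derivCLM_mulLinf f g))
      (fun f f' g => H1.ext' (by simp) (by simp; abel))
      (fun c f g => by apply H1.ext' <;> simp)
      (fun f g g' => H1.ext' (by simp) (by simp; abel))
      (fun c f g => by apply H1.ext' <;> simp))
    3 H1.norm_mk_mulLinf_le

instance : Mul H1 := ⟨fun f g => mulCLM f g⟩

theorem H1.mul_def (f g : H1) : f * g = mulCLM f g := rfl

theorem H1.norm_mul_le (f g : H1) : ‖f * g‖ ≤ 3 * ‖f‖ * ‖g‖ :=
  mulCLM.le_of_opNorm₂_le_of_le (LinearMap.mkContinuous₂_norm_le _ (by norm_num) _) le_rfl le_rfl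

theorem toL2_mul (f g : H1) : toL2 (f * g) = mulLinf (toLinf f) (toL2 g) := rfl

theorem coeFn_toL2_mul (f g : H1) : toL2 (f * g) =ᵐ[volume] fun x => toL2 f x * toL2 g x := by
  filter_upwards [coeFn_mulLinf (toLinf f) (toL2 g), coeFn_toLinf f] with x hprod hf
  rw [toL2_mul, hprod, hf]

theorem norm_toL2_mul_le (f g : H1) : ‖toL2 (f * g)‖ ≤ ‖toLinf f‖ * ‖toL2 g‖ :=
  norm_mulLinf_le _ _

instance : NonUnitalCommRing H1 where
  left_distrib f g h := map_add (mulCLM f) g h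
  right_distrib f g h := mulCLM.map_add₂ f g h
  zero_mul g := mulCLM.map_zero₂ g
  mul_zero f := map_zero (mulCLM f)
  mul_assoc f g h := H1.ext_ae <| by
    filter_upwards [coeFn_toL2_mul f g, coeFn_toL2_mul (f * g) h, coeFn_toL2_mul g h,
      coeFn_toL2_mul f (g * h)] with x hfg hfg_h hgh hf_gh
    rw [hfg_h, hfg, hf_gh, hgh, mul_assoc]
  mul_comm f g := H1.ext_ae <| by
    filter_upwards [coeFn_toL2_mul f g, coeFn_toL2_mul g f] with x hfg hgf
    rw [hfg, hgf, mul_comm]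

instance : ContinuousMul H1 := ⟨mulCLM.continuous₂⟩

/-- Complex conjugation on `L²`. -/
def conjL2 : L2 →L[ℝ] L2 := (Complex.conjCLE : ℂ →L[ℝ] ℂ).compLpL 2 volume

theorem coeFn_conjL2 (a : L2) : conjL2 a =ᵐ[volume] fun x => star (a x) :=
  ContinuousLinearMap.coeFn_compLpL _ a

theorem norm_conjL2 (a : L2) : ‖conjL2 a‖ = ‖a‖ := by
  apply le_antisymm <;> apply Lp.norm_le_norm_of_ae_le <;>
  · filter_upwards [coeFn_conjL2 a] with x hx
    rw [hx, norm_star]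

theorem conjL2_toLp (φ : 𝓢(ℝ, ℂ)) : conjL2 (φ.toLp 2) = (conjSchwartz φ).toLp 2 := by
  apply Lp.ext
  filter_upwards [coeFn_conjL2 (φ.toLp 2), φ.coeFn_toLp 2 volume,
    (conjSchwartz φ).coeFn_toLp 2 volume] with x hconj hφ hφ'
  rw [hconj, hφ, hφ', conjSchwartz_apply]

theorem derivCLM_conjL2 (f : H1) :
    TemperedDistribution.derivCLM ℂ (conjL2 (toL2 f) : 𝓢'(ℝ, ℂ))
      = (conjL2 (dx f) : 𝓢'(ℝ, ℂ)) := by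
  refine denseRange_ofSchwartz.induction_on (p := fun f : H1 =>
    TemperedDistribution.derivCLM ℂ (conjL2 (toL2 f) : 𝓢'(ℝ, ℂ)) = (conjL2 (dx f) : 𝓢'(ℝ, ℂ)))
    f (isClosed_setOf_derivCLM_eq (by fun_prop) (by fun_prop)) fun φ => ?_
  rw [toL2_ofSchwartz, dx_ofSchwartz, conjL2_toLp, conjL2_toLp, ← derivCLM_conjSchwartz]
  exact (H1.ofSchwartz (conjSchwartz φ)).derivCLM_toL2

instance : Star H1 := ⟨fun f => H1.mk _ _ (derivCLM_conjL2 f)⟩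

@[simp] theorem toL2_star (f : H1) : toL2 (star f) = conjL2 (toL2 f) := rfl

@[simp] theorem dx_star (f : H1) : dx (star f) = conjL2 (dx f) := rfl

theorem coeFn_toL2_star (f : H1) : toL2 (star f) =ᵐ[volume] fun x => star (toL2 f x) :=
  coeFn_conjL2 _

instance : StarRing H1 where
  star_involutive f := H1.ext_ae <| by
    filter_upwards [coeFn_toL2_star f, coeFn_toL2_star (star f)] with x hf hff
    rw [hff, hf, star_star]
  star_mul f g := H1.ext_ae <| by
    filter_upwards [coeFn_toL2_star f, coeFn_toL2_star g, coeFn_toL2_star (f * g),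
      coeFn_toL2_mul f g, coeFn_toL2_mul (star g) (star f)] with x hf hg hfg hmul hmul'
    rw [hfg, hmul, hmul', hf, hg, star_mul]
  star_add f g := toL2_injective (by simp)

instance : NormedStarGroup H1 where
  norm_star_le f := le_of_sq_le_sq (by simp [H1.norm_sq_eq, norm_conjL2]) (norm_nonneg f)

instance : StarModule ℂ H1 where
  star_smul c f := H1.ext_ae <| by
    rw [map_smul toL2]
    filter_upwards [coeFn_toL2_star (c • f), coeFn_toL2_star f,
      (by rw [map_smul]; exact Lp.coeFn_smul c (toL2 f) :
        toL2 (c • f) =ᵐ[volume] c • ⇑(toL2 f)),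
      Lp.coeFn_smul (star c) (toL2 (star f))] with x hcf hf hsmul hsmul'
    rw [hcf, hsmul, hsmul', Pi.smul_apply, Pi.smul_apply, hf, star_smul]

/-- The bilinear pairing `(a, b) ↦ ∫ a b` on `L²`. -/
def pairL2 : L2 →L[ℂ] L2 →L[ℂ] ℂ := (ContinuousLinearMap.mul ℂ ℂ).lpPairing volume 2 2

theorem pairL2_apply (a b : L2) : pairL2 a b = ∫ x, a x * b x := by
  simp [pairL2, ContinuousLinearMap.lpPairing_eq_integral]

theorem pairL2_comm (a b : L2) : pairL2 a b = pairL2 b a := by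
  simp only [pairL2_apply, mul_comm]

theorem pairL2_conjL2_left (a b : L2) : pairL2 (conjL2 a) b = inner ℂ a b := by
  rw [pairL2_apply, L2.inner_def]
  apply integral_congr_ae
  filter_upwards [coeFn_conjL2 a] with x hx
  rw [hx, RCLike.inner_apply, mul_comm]
  rfl

theorem star_pairL2 (a b : L2) : star (pairL2 a b) = pairL2 (conjL2 a) (conjL2 b) := by
  rw [pairL2_apply, pairL2_apply]
  refine integral_conj.symm.trans (integral_congr_ae ?_)
  filter_upwards [coeFn_conjL2 a, coeFn_conjL2 b] with x ha hb
  rw [ha, hb]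
  exact map_mul (starRingEnd ℂ) _ _

/-- The embedding `H¹ → H⁻¹` as a continuous linear map. -/
def toHNeg1L : H1 →L[ℂ] HNeg1 := pairL2.bilinearComp toL2 toL2

/-- The Dirichlet form `(f, g) ↦ ∫ f' g'` as an operator `H¹ → H⁻¹`, that is `-∂ₓ²`. -/
def dirichletForm : H1 →L[ℂ] HNeg1 := pairL2.bilinearComp dx dx

theorem toHNeg1L_apply (f g : H1) : toHNeg1L f g = pairL2 (toL2 f) (toL2 g) := rfl

theorem dirichletForm_apply (f g : H1) : dirichletForm f g = pairL2 (dx f) (dx g) := rfl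

theorem toHNeg1L_comm (f g : H1) : toHNeg1L f g = toHNeg1L g f := pairL2_comm _ _

theorem dirichletForm_comm (f g : H1) : dirichletForm f g = dirichletForm g f := pairL2_comm _ _

theorem star_toHNeg1L (f g : H1) : star (toHNeg1L f g) = toHNeg1L (star f) (star g) :=
  star_pairL2 _ _

theorem star_dirichletForm (f g : H1) :
    star (dirichletForm f g) = dirichletForm (star f) (star g) := star_pairL2 _ _

theorem toHNeg1L_star (f g : H1) : toHNeg1L (star f) g = inner ℂ (toL2 f) (toL2 g) :=
  pairL2_conjL2_left _ _

theorem dirichletForm_star (f g : H1) : dirichletForm (star f) g = inner ℂ (dx f) (dx g) :=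
  pairL2_conjL2_left _ _

theorem toHNeg1L_mul (f g h : H1) : toHNeg1L (f * g) h = toHNeg1L f (g * h) := by
  rw [toHNeg1L_apply, toHNeg1L_apply, pairL2_apply, pairL2_apply]
  apply integral_congr_ae
  filter_upwards [coeFn_toL2_mul f g, coeFn_toL2_mul g h] with x hfg hgh
  rw [hfg, hgh, mul_assoc]

/-- The operator `i ∂ₓ² : H¹ → H⁻¹` generating the free Schrödinger group. -/
def schrodingerOp : H1 →L[ℂ] HNeg1 := (-Complex.I) • dirichletForm

theorem schrodingerOp_apply (f g : H1) : schrodingerOp f g = -Complex.I * dirichletForm f g := rfl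

/-- The Fourier multiplier `exp (-4π²itξ²)` of the free Schrödinger group `exp (it∂ₓ²)`. -/
def symbol (t ξ : ℝ) : ℂ := Complex.exp ((-(4 * π ^ 2 * t * ξ ^ 2) : ℝ) * Complex.I)

theorem norm_symbol (t ξ : ℝ) : ‖symbol t ξ‖ = 1 := Complex.norm_exp_ofReal_mul_I _

theorem symbol_add (s t ξ : ℝ) : symbol (s + t) ξ = symbol s ξ * symbol t ξ := by
  rw [symbol, symbol, symbol, ← Complex.exp_add]
  congr 1
  push_cast
  ring

theorem symbol_zero (ξ : ℝ) : symbol 0 ξ = 1 := by simp [symbol]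

theorem continuous_symbol (t : ℝ) : Continuous (symbol t) := by
  unfold symbol
  fun_prop

theorem hasDerivAt_symbol (t ξ : ℝ) :
    HasDerivAt (fun t => symbol t ξ) (-Complex.I * (4 * π ^ 2 * ξ ^ 2 : ℝ) * symbol t ξ) t := by
  have hphase : HasDerivAt (fun t : ℝ => -(4 * π ^ 2 * t * ξ ^ 2)) (-(4 * π ^ 2 * ξ ^ 2)) t := by
    simpa using (((hasDerivAt_id t).const_mul (4 * π ^ 2)).mul_const (ξ ^ 2)).fun_neg
  refine (hphase.ofReal_comp.mul_const Complex.I).cexp.congr_deriv ?_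
  change symbol t ξ * _ = _
  push_cast
  ring

theorem memLp_symbol (t : ℝ) : MemLp (symbol t) ∞ volume :=
  memLp_top_of_bound (continuous_symbol t).aestronglyMeasurable 1
    (Eventually.of_forall fun ξ => (norm_symbol t ξ).le)

theorem L2.fourier_injective {a b : L2} (h : (𝓕 a : L2) =ᵐ[volume] (𝓕 b : L2)) : a = b :=
  (Lp.fourierTransformₗᵢ ℝ ℂ).injective (Lp.ext h)

theorem norm_mulLinf_symbol (t : ℝ) (a : L2) : ‖mulLinf (memLp_symbol t).toLp a‖ = ‖a‖ := by
  apply le_antisymm <;> apply Lp.norm_le_norm_of_ae_le <;>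
  · filter_upwards [coeFn_mulLinf (memLp_symbol t).toLp a, (memLp_symbol t).coeFn_toLp]
      with ξ hprod hsymbol
    rw [hprod, hsymbol, norm_mul, norm_symbol, one_mul]

/-- The free Schrödinger group `exp (it∂ₓ²)` on `L²`. -/
def freeL2 (t : ℝ) : L2 →ₗᵢ[ℂ] L2 :=
  (Lp.fourierTransformₗᵢ ℝ ℂ).symm.toLinearIsometry.comp
    (LinearIsometry.comp ⟨(mulLinf (memLp_symbol t).toLp : L2 →ₗ[ℂ] L2), norm_mulLinf_symbol t⟩
      (Lp.fourierTransformₗᵢ ℝ ℂ).toLinearIsometry)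

theorem fourier_freeL2 (t : ℝ) (a : L2) :
    (𝓕 (freeL2 t a) : L2) =ᵐ[volume] fun ξ => symbol t ξ * (𝓕 a : L2) ξ := by
  have h : 𝓕 (freeL2 t a) = mulLinf (memLp_symbol t).toLp (𝓕 a) :=
    (Lp.fourierTransformₗᵢ ℝ ℂ).apply_symm_apply _
  rw [h]
  filter_upwards [coeFn_mulLinf (memLp_symbol t).toLp (𝓕 a), (memLp_symbol t).coeFn_toLp]
    with ξ hprod hsymbol
  rw [hprod, hsymbol]

theorem freeL2_add (s t : ℝ) (a : L2) : freeL2 (s + t) a = freeL2 s (freeL2 t a) := by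
  apply L2.fourier_injective
  filter_upwards [fourier_freeL2 (s + t) a, fourier_freeL2 s (freeL2 t a), fourier_freeL2 t a]
    with ξ hst hs ht
  rw [hst, hs, ht, symbol_add, mul_assoc]

theorem freeL2_zero (a : L2) : freeL2 0 a = a := by
  apply L2.fourier_injective
  filter_upwards [fourier_freeL2 0 a] with ξ h
  rw [h, symbol_zero, one_mul]

theorem inner_freeL2_right (t : ℝ) (a b : L2) :
    inner ℂ b (freeL2 t a) = ∫ ξ, symbol t ξ * inner ℂ ((𝓕 b : L2) ξ) ((𝓕 a : L2) ξ) := by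
  rw [← Lp.inner_fourier_eq, L2.inner_def]
  apply integral_congr_ae
  filter_upwards [fourier_freeL2 t a] with ξ h
  rw [h, ← smul_eq_mul (symbol t ξ), inner_smul_right]

theorem continuous_inner_freeL2 (a b : L2) : Continuous fun t => inner ℂ b (freeL2 t a) := by
  have hint := L2.integrable_inner (𝕜 := ℂ) (𝓕 b : L2) (𝓕 a)
  simp_rw [inner_freeL2_right]
  refine continuous_of_dominated (bound := fun ξ => ‖inner ℂ ((𝓕 b : L2) ξ) ((𝓕 a : L2) ξ)‖)
    (fun t => (continuous_symbol t).aestronglyMeasurable.mul hint.aestronglyMeasurable)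
    (fun t => ?_) hint.norm ?_
  · filter_upwards with ξ
    rw [norm_mul, norm_symbol, one_mul]
  · filter_upwards with ξ
    exact (continuous_iff_continuousAt.2 fun t => (hasDerivAt_symbol t ξ).continuousAt).mul
      continuous_const

theorem tendsto_of_tendsto_inner_of_norm_eq {𝕜 E ι : Type*} [RCLike 𝕜] [NormedAddCommGroup E]
    [InnerProductSpace 𝕜 E] {l : Filter ι} {g : ι → E} {y : E} (hnorm : ∀ i, ‖g i‖ = ‖y‖)
    (hinner : Tendsto (fun i => inner 𝕜 y (g i)) l (𝓝 (inner 𝕜 y y))) : Tendsto g l (𝓝 y) := by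
  have hsq (i : ι) : ‖g i - y‖ ^ 2 = 2 * ‖y‖ ^ 2 - 2 * RCLike.re (inner 𝕜 y (g i)) := by
    rw [norm_sub_sq (𝕜 := 𝕜), hnorm, inner_re_symm]
    ring
  have hlim := (((RCLike.continuous_re.tendsto _).comp hinner).const_mul 2).const_sub (2 * ‖y‖ ^ 2)
  rw [inner_self_eq_norm_sq, sub_self] at hlim
  rw [tendsto_iff_norm_sub_tendsto_zero]
  simpa only [Function.comp_def, ← hsq, Real.sqrt_sq (norm_nonneg _), Real.sqrt_zero]
    using hlim.sqrt

theorem continuous_freeL2 (a : L2) : Continuous fun t => freeL2 t a :=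
  continuous_iff_continuousAt.2 fun s => tendsto_of_tendsto_inner_of_norm_eq (𝕜 := ℂ)
    (fun t => by simp only [LinearIsometry.norm_map])
    ((continuous_inner_freeL2 a (freeL2 s a)).tendsto s)

theorem derivCLM_freeL2 (t : ℝ) (f : H1) :
    TemperedDistribution.derivCLM ℂ (freeL2 t (toL2 f) : 𝓢'(ℝ, ℂ))
      = (freeL2 t (dx f) : 𝓢'(ℝ, ℂ)) := by
  rw [L2.derivCLM_eq_iff_fourier]
  filter_upwards [fourier_freeL2 t (toL2 f), fourier_freeL2 t (dx f), fourier_dx f]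
    with ξ hf hdf hdx
  rw [hf, hdf, hdx]
  ring

/-- The free Schrödinger group `exp (it∂ₓ²)` on `H¹`. -/
def free (t : ℝ) : H1 →ₗᵢ[ℂ] H1 where
  toFun f := H1.mk _ _ (derivCLM_freeL2 t f)
  map_add' f g := toL2_injective (by simp)
  map_smul' c f := toL2_injective (by simp)
  norm_map' f := by
    rw [← sq_eq_sq₀ (norm_nonneg _) (norm_nonneg _), H1.norm_sq_eq, H1.norm_sq_eq]
    exact congrArg₂ (fun x y : ℝ => x ^ 2 + y ^ 2) ((freeL2 t).norm_map _) ((freeL2 t).norm_map _)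

@[simp] theorem toL2_free (t : ℝ) (f : H1) : toL2 (free t f) = freeL2 t (toL2 f) := rfl

@[simp] theorem dx_free (t : ℝ) (f : H1) : dx (free t f) = freeL2 t (dx f) := rfl

theorem free_add (s t : ℝ) (f : H1) : free (s + t) f = free s (free t f) :=
  toL2_injective (freeL2_add s t _)

theorem free_zero (f : H1) : free 0 f = f := toL2_injective (freeL2_zero _)

theorem free_free_neg (t : ℝ) (f : H1) : free t (free (-t) f) = f := by
  rw [← free_add, add_neg_cancel, free_zero]

theorem continuous_free_left (f : H1) : Continuous fun t => free t f := by
  refine continuous_iff_continuousAt.2 fun s => tendsto_iff_norm_sub_tendsto_zero.2 ?_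
  have hL2 := tendsto_iff_norm_sub_tendsto_zero.1 ((continuous_freeL2 (toL2 f)).tendsto s)
  have hdx := tendsto_iff_norm_sub_tendsto_zero.1 ((continuous_freeL2 (dx f)).tendsto s)
  exact squeeze_zero (fun _ => norm_nonneg _) (fun t => by simpa using H1.norm_le_add _)
    (by simpa using hL2.add hdx)

theorem continuous_free : Continuous fun p : ℝ × H1 => free p.1 p.2 :=
  continuous_prod_of_continuous_lipschitzWith' _ 1 (fun t => (free t).lipschitz)
    continuous_free_left

theorem hasDerivAt_of_forall_apply {ι E F : Type*} [NormedAddCommGroup E] [NormedSpace ℝ E]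
    [CompleteSpace E] [NormedAddCommGroup F] [NormedSpace ℝ F] [CompleteSpace F]
    (ℓ : ι → E →L[ℝ] F) (hℓ : ∀ x y, (∀ i, ℓ i x = ℓ i y) → x = y) {g g' : ℝ → E}
    (hg' : Continuous g') (h : ∀ i t, HasDerivAt (fun s => ℓ i (g s)) (ℓ i (g' t)) t) (t : ℝ) :
    HasDerivAt g (g' t) t := by
  have hg : g = fun t => g 0 + ∫ s in (0 : ℝ)..t, g' s := by
    funext s
    refine hℓ _ _ fun i => ?_
    rw [map_add, ← (ℓ i).intervalIntegral_comp_comm (hg'.intervalIntegrable 0 s),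
      intervalIntegral.integral_eq_sub_of_hasDerivAt (fun x _ => h i x)
        (((ℓ i).continuous.comp hg').intervalIntegrable 0 s), add_sub_cancel]
  rw [hg]
  exact (hg'.integral_hasStrictDerivAt 0 t).hasDerivAt.const_add _

theorem inner_fourier_dx (f g : H1) : ∀ᵐ ξ : ℝ,
    inner ℂ ((𝓕 (dx f) : L2) ξ) ((𝓕 (dx g) : L2) ξ)
      = (4 * π ^ 2 * ξ ^ 2 : ℝ) * inner ℂ ((𝓕 (toL2 f) : L2) ξ) ((𝓕 (toL2 g) : L2) ξ) := by
  filter_upwards [fourier_dx f, fourier_dx g] with ξ hf hg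
  rw [hf, hg]
  simp only [RCLike.inner_apply, map_mul, Complex.conj_ofReal, Complex.conj_I, map_ofNat]
  push_cast
  linear_combination (-4 * π ^ 2 * ξ ^ 2 * (𝓕 (toL2 g) : L2) ξ
    * starRingEnd ℂ ((𝓕 (toL2 f) : L2) ξ)) * Complex.I_sq

theorem hasDerivAt_inner_freeL2 (f g : H1) (t : ℝ) :
    HasDerivAt (fun s => inner ℂ (toL2 g) (freeL2 s (toL2 f)))
      (-Complex.I * inner ℂ (dx g) (freeL2 t (dx f))) t := by
  have hint := L2.integrable_inner (𝕜 := ℂ) (𝓕 (toL2 g) : L2) (𝓕 (toL2 f))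
  let F' (s ξ : ℝ) : ℂ := -Complex.I * (4 * π ^ 2 * ξ ^ 2 : ℝ) * symbol s ξ
    * inner ℂ ((𝓕 (toL2 g) : L2) ξ) ((𝓕 (toL2 f) : L2) ξ)
  have hF' : ∀ᵐ ξ : ℝ, ∀ s, F' s ξ = -Complex.I
      * (symbol s ξ * inner ℂ ((𝓕 (dx g) : L2) ξ) ((𝓕 (dx f) : L2) ξ)) := by
    filter_upwards [inner_fourier_dx g f] with ξ h s
    rw [h]
    ring
  have hmain := (hasDerivAt_integral_of_dominated_loc_of_deriv_le (μ := volume) (x₀ := t)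
    (F := fun s ξ => symbol s ξ * inner ℂ ((𝓕 (toL2 g) : L2) ξ) ((𝓕 (toL2 f) : L2) ξ))
    (F' := F') (bound := fun ξ => ‖inner ℂ ((𝓕 (dx g) : L2) ξ) ((𝓕 (dx f) : L2) ξ)‖)
    Filter.univ_mem
    (Eventually.of_forall fun s =>
      (continuous_symbol s).aestronglyMeasurable.mul hint.aestronglyMeasurable)
    (hint.mono ((continuous_symbol t).aestronglyMeasurable.mul hint.aestronglyMeasurable)
      (Eventually.of_forall fun ξ => by rw [norm_mul, norm_symbol, one_mul]))
    ?_ ?_ (L2.integrable_inner (𝕜 := ℂ) (𝓕 (dx g) : L2) (𝓕 (dx f))).norm ?_).2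
  · simp_rw [inner_freeL2_right, ← integral_const_mul]
    exact hmain.congr_deriv (integral_congr_ae (hF'.mono fun ξ h => h t))
  · have hcont := continuous_symbol t
    exact AEStronglyMeasurable.mul (Continuous.aestronglyMeasurable (by fun_prop))
      hint.aestronglyMeasurable
  · filter_upwards [hF'] with ξ h s _
    rw [h, norm_mul, norm_mul, norm_symbol, norm_neg, Complex.norm_I, one_mul, one_mul]
  · filter_upwards with ξ s _
    exact (hasDerivAt_symbol s ξ).mul_const _

theorem hasDerivAt_toHNeg1L_free (f : H1) (t : ℝ) :
    HasDerivAt (fun s => toHNeg1L (free s f)) (schrodingerOp (free t f)) t := by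
  refine hasDerivAt_of_forall_apply
    (fun φ : H1 => (ContinuousLinearMap.apply ℂ ℂ φ).restrictScalars ℝ)
    (fun _ _ h => ContinuousLinearMap.ext h)
    (g' := fun t => schrodingerOp (free t f))
    (schrodingerOp.continuous.comp (continuous_free_left f)) (fun φ t => ?_) t
  have hpair (s : ℝ) : toHNeg1L (free s f) φ = inner ℂ (toL2 (star φ)) (freeL2 s (toL2 f)) := by
    rw [← toL2_free, ← toHNeg1L_star, star_star, toHNeg1L_comm]
  refine ((hasDerivAt_inner_freeL2 f (star φ) t).congr_deriv ?_).congr_of_eventuallyEq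
    (Eventually.of_forall hpair)
  rw [← dx_free, ← dirichletForm_star, star_star, dirichletForm_comm]
  rfl

theorem hasDerivAt_toHNeg1L_free_comp {z : ℝ → H1} {z' : H1} {t : ℝ} (hz : HasDerivAt z z' t) :
    HasDerivAt (fun s => toHNeg1L (free s (z s)))
      (schrodingerOp (free t (z t)) + toHNeg1L (free t z')) t := by
  have hincr : HasDerivAt (fun s => toHNeg1L (free s (z s - z t))) (toHNeg1L (free t z')) t := by
    rw [hasDerivAt_iff_tendsto_slope] at hz ⊢
    have hslope : Tendsto (fun s => (s, slope z t s)) (𝓝[≠] t) (𝓝 (t, z')) :=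
      (tendsto_id.mono_left nhdsWithin_le_nhds).prodMk_nhds hz
    refine ((toHNeg1L.continuous.comp continuous_free).tendsto (t, z')).comp hslope |>.congr
      fun s => ?_
    rw [Function.comp_apply, Function.comp_apply, slope_def_module, slope_def_module, sub_self,
      map_zero, map_zero, sub_zero, ← Complex.coe_smul, ← Complex.coe_smul, map_smul, map_smul]
  refine ((hasDerivAt_toHNeg1L_free (z t) t).add hincr).congr_of_eventuallyEq
    (Eventually.of_forall fun s => ?_)
  rw [Pi.add_apply, ← map_add, ← map_add, add_sub_cancel]

section ODE

variable {E : Type*} [NormedAddCommGroup E] [NormedSpace ℝ E]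

/-- The radial retraction of a normed space onto its closed ball of radius `R > 0`, used to
truncate vector fields that are only Lipschitz on bounded sets. -/
def ballRetraction (R : ℝ) (x : E) : E := (R / max R ‖x‖) • x

theorem ballRetraction_of_norm_le {R : ℝ} (hR : 0 < R) {x : E} (hx : ‖x‖ ≤ R) :
    ballRetraction R x = x := by
  rw [ballRetraction, max_eq_left hx, div_self hR.ne', one_smul]

theorem norm_ballRetraction_le {R : ℝ} (hR : 0 < R) (x : E) : ‖ballRetraction R x‖ ≤ R := by
  have hmax : 0 < max R ‖x‖ := lt_max_of_lt_left hR
  rw [ballRetraction, norm_smul, Real.norm_of_nonneg (by positivity), div_mul_eq_mul_div,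
    div_le_iff₀ hmax]
  gcongr
  exact le_max_right _ _

theorem lipschitzWith_ballRetraction {R : ℝ} (hR : 0 < R) :
    LipschitzWith 2 (ballRetraction R : E → E) := by
  refine LipschitzWith.of_dist_le_mul fun x y => ?_
  set m := max R ‖x‖
  set n := max R ‖y‖
  have hRm : R ≤ m := le_max_left _ _
  have hyn : ‖y‖ ≤ n := le_max_right _ _
  have hm : 0 < m := hR.trans_le hRm
  have hn : 0 < n := hR.trans_le (le_max_left _ _)
  have hmn : |n - m| ≤ ‖x - y‖ := by
    rw [norm_sub_rev]
    exact (abs_max_sub_max_le_max R ‖y‖ R ‖x‖).trans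
      (max_le (by simp) (abs_norm_sub_norm_le y x))
  have hsplit : ballRetraction R x - ballRetraction R y
      = (R / m) • (x - y) + (R / m * ((n - m) / n)) • y := by
    have hcoef : R / n = R / m - R / m * ((n - m) / n) := by
      field_simp
      ring
    change (R / m) • x - (R / n) • y = _
    rw [hcoef]
    module
  have hRm1 : R / m ≤ 1 := (div_le_one hm).2 hRm
  rw [dist_eq_norm, dist_eq_norm, hsplit]
  calc ‖(R / m) • (x - y) + (R / m * ((n - m) / n)) • y‖
      ≤ R / m * ‖x - y‖ + R / m * (|n - m| / n) * ‖y‖ := by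
        refine (norm_add_le _ _).trans_eq ?_
        rw [norm_smul, norm_smul, norm_mul, norm_div (n - m), Real.norm_of_nonneg hn.le,
          Real.norm_of_nonneg (by positivity : 0 ≤ R / m), Real.norm_eq_abs]
    _ ≤ 1 * ‖x - y‖ + 1 * (‖x - y‖ / n) * n := by gcongr
    _ = (2 : ℝ≥0) * ‖x - y‖ := by
        rw [NNReal.coe_ofNat]
        field_simp
        ring

theorem norm_le_mul_exp_of_norm_deriv_le {Y Y' : ℝ → E} {K T : ℝ}
    (hY : ∀ t ∈ Ioo (-T) T, HasDerivAt Y (Y' t) t)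
    (hle : ∀ t ∈ Ioo (-T) T, ‖Y' t‖ ≤ K * ‖Y t‖) {t : ℝ} (ht : t ∈ Ioo (-T) T) :
    ‖Y t‖ ≤ ‖Y 0‖ * Real.exp (K * |t|) := by
  have forward {X X' : ℝ → E} (hX : ∀ s ∈ Ioo (-T) T, HasDerivAt X (X' s) s)
      (hle : ∀ s ∈ Ioo (-T) T, ‖X' s‖ ≤ K * ‖X s‖) {r : ℝ} (hr₀ : 0 ≤ r) (hr : r < T) :
      ‖X r‖ ≤ ‖X 0‖ * Real.exp (K * r) := by
    have hsub : Icc 0 r ⊆ Ioo (-T) T := fun s hs => ⟨by linarith [hs.1], hs.2.trans_lt hr⟩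
    have h := norm_le_gronwallBound_of_norm_deriv_right_le (ε := 0)
      (fun s hs => (hX s (hsub hs)).continuousAt.continuousWithinAt)
      (fun s hs => (hX s (hsub (Ico_subset_Icc_self hs))).hasDerivWithinAt) le_rfl
      (fun s hs => by simpa only [add_zero] using hle s (hsub (Ico_subset_Icc_self hs)))
      r (right_mem_Icc.2 hr₀)
    rwa [gronwallBound_ε0, sub_zero] at h
  rcases le_total 0 t with h | h
  · rw [abs_of_nonneg h]
    exact forward hY hle h ht.2
  · have hneg {s : ℝ} (hs : s ∈ Ioo (-T) T) : -s ∈ Ioo (-T) T :=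
      ⟨by linarith [hs.2], by linarith [hs.1]⟩
    have hrev := forward (X := fun s => Y (-s)) (X' := fun s => -Y' (-s)) (r := -t)
      (fun s hs => ((hY _ (hneg hs)).scomp s (hasDerivAt_neg s)).congr_deriv (neg_one_smul ℝ _))
      (fun s hs => by simpa only [norm_neg] using hle _ (hneg hs))
      (by linarith) (by linarith [ht.1])
    simpa only [neg_neg, neg_zero, abs_of_nonpos h] using hrev

theorem forall_Icc_lt_of_forall_abs_lt {φ : ℝ → ℝ} {R T : ℝ} (hφ : ContinuousOn φ (Icc (-T) T))
    (h : ∀ s ∈ Icc (-T) T, (∀ t ∈ Ioo (-|s|) |s|, φ t < R) → φ s < R) :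
    ∀ s ∈ Icc (-T) T, φ s < R := by
  by_contra! hne
  have hcompact : IsCompact {s ∈ Icc (-T) T | R ≤ φ s} :=
    isCompact_Icc.of_isClosed_subset
      (hφ.preimage_isClosed_of_isClosed isClosed_Icc isClosed_Ici) (sep_subset _ _)
  obtain ⟨s, ⟨hsT, hsR⟩, hmin⟩ := hcompact.exists_isMinOn hne continuous_abs.continuousOn
  refine hsR.not_gt (h s hsT fun t ht => ?_)
  by_contra! htR
  have hts : |t| < |s| := abs_lt.2 ht
  exact hts.not_ge (hmin ⟨abs_le.1 (hts.le.trans (abs_le.2 hsT)), htR⟩)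

variable {f : ℝ → E → E}

theorem exists_hasDerivAt_Ioo_of_lipschitzWith [CompleteSpace E] {K L : ℝ≥0} {T : ℝ} (hT : 0 ≤ T)
    (hlip : ∀ t, LipschitzWith K (f t)) (hcont : ∀ x, Continuous fun t => f t x)
    (hbound : ∀ t ∈ Icc (-T) T, ∀ x, ‖f t x‖ ≤ L) (x₀ : E) :
    ∃ z : ℝ → E, z 0 = x₀ ∧ ContinuousOn z (Icc (-T) T) ∧
      ∀ t ∈ Ioo (-T) T, HasDerivAt z (f t (z t)) t := by
  have h0 : (0 : ℝ) ∈ Icc (-T) T := ⟨by linarith, hT⟩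
  have h : IsPicardLindelof f (⟨0, h0⟩ : Icc (-T) T) x₀ (L * ⟨T, hT⟩) 0 L K :=
    { lipschitzOnWith := fun t _ => (hlip t).lipschitzOnWith
      continuousOn := fun x _ => (hcont x).continuousOn
      norm_le := fun t ht x _ => hbound t ht x
      mul_max_le := by
        simp only [sub_zero, zero_sub, neg_neg, max_self, NNReal.coe_zero]
        rfl }
  obtain ⟨z, hz0, hz⟩ := h.exists_eq_forall_mem_Icc_hasDerivWithinAt₀
  exact ⟨z, hz0, fun t ht => (hz t ht).continuousWithinAt,
    fun t ht => (hz t (Ioo_subset_Icc_self ht)).hasDerivAt (Icc_mem_nhds ht.1 ht.2)⟩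

theorem exists_hasDerivAt_Ioo_ballRetraction [CompleteSpace E] {R T : ℝ} (hR : 0 < R)
    (hT : 0 ≤ T) {K : ℝ≥0} (hlip : ∀ t, LipschitzOnWith K (f t) (closedBall 0 R))
    (hcont : ∀ x, Continuous fun t => f t x) (x₀ : E) :
    ∃ z : ℝ → E, z 0 = x₀ ∧ ContinuousOn z (Icc (-T) T) ∧
      ∀ t ∈ Ioo (-T) T, HasDerivAt z (f t (ballRetraction R (z t))) t := by
  have hmem (x : E) : ballRetraction R x ∈ closedBall (0 : E) R :=
    mem_closedBall_zero_iff.2 (norm_ballRetraction_le hR x)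
  obtain ⟨M, hM⟩ := isCompact_Icc.exists_bound_of_continuousOn (s := Icc (-T) T)
    (hcont 0).continuousOn
  refine exists_hasDerivAt_Ioo_of_lipschitzWith (f := fun t x => f t (ballRetraction R x))
    (K := K * 2) (L := Real.toNNReal (M + K * R)) hT (fun t => ?_) (fun x => hcont _)
    (fun t ht x => ?_) x₀
  · rw [← lipschitzOnWith_univ]
    exact (hlip t).comp (lipschitzWith_ballRetraction hR).lipschitzOnWith fun x _ => hmem x
  · calc ‖f t (ballRetraction R x)‖
        ≤ ‖f t 0‖ + ‖f t (ballRetraction R x) - f t 0‖ := norm_le_norm_add_norm_sub' _ _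
      _ ≤ M + K * R := by
        gcongr
        · exact hM t ht
        · rw [← dist_eq_norm]
          refine ((hlip t).dist_le_mul _ (hmem x) 0 (mem_closedBall_self hR.le)).trans ?_
          gcongr
          exact mem_closedBall.1 (hmem x)
      _ ≤ _ := Real.le_coe_toNNReal _

theorem exists_hasDerivAt_Ioo [CompleteSpace E]
    (hlip : ∀ R : ℝ, ∃ K : ℝ≥0, ∀ t, LipschitzOnWith K (f t) (closedBall 0 R))
    (hcont : ∀ x, Continuous fun t => f t x) {x₀ : E} {B T : ℝ} (hT : 0 < T)
    (hbound : ∀ S ≤ T, ∀ z : ℝ → E, z 0 = x₀ →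
      (∀ t ∈ Ioo (-S) S, HasDerivAt z (f t (z t)) t) → ∀ t ∈ Ioo (-S) S, ‖z t‖ ≤ B) :
    ∃ z : ℝ → E, z 0 = x₀ ∧ ∀ t ∈ Ioo (-T) T, HasDerivAt z (f t (z t)) t := by
  set R := max B ‖x₀‖ + 1
  have hBR : B < R := (le_max_left _ _).trans_lt (lt_add_one _)
  have hxR : ‖x₀‖ < R := (le_max_right _ _).trans_lt (lt_add_one _)
  have hR : 0 < R := (norm_nonneg _).trans_lt hxR
  obtain ⟨K, hK⟩ := hlip R
  obtain ⟨z, hz0, hzcont, hz⟩ := exists_hasDerivAt_Ioo_ballRetraction hR hT.le hK hcont x₀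
  have untruncate {t : ℝ} (ht : t ∈ Ioo (-T) T) (hzt : ‖z t‖ < R) :
      HasDerivAt z (f t (z t)) t := by
    simpa only [ballRetraction_of_norm_le hR hzt.le] using hz t ht
  have hlt : ∀ t ∈ Icc (-T) T, ‖z t‖ < R := by
    refine forall_Icc_lt_of_forall_abs_lt hzcont.norm fun s hs hbefore => ?_
    rcases eq_or_ne s 0 with rfl | hs0
    · rwa [hz0]
    have hsT : |s| ≤ T := abs_le.2 hs
    have hsub : Ioo (-|s|) |s| ⊆ Ioo (-T) T := Ioo_subset_Ioo (neg_le_neg hsT) hsT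
    have hle : ∀ t ∈ Ioo (-|s|) |s|, ‖z t‖ ≤ B :=
      hbound |s| hsT z hz0 fun t ht => untruncate (hsub ht) (hbefore t ht)
    have hcl : s ∈ closure (Ioo (-|s|) |s|) := by
      rw [closure_Ioo (by linarith [abs_pos.2 hs0])]
      exact abs_le.1 le_rfl
    have hzs : ContinuousWithinAt (fun t => ‖z t‖) (Ioo (-|s|) |s|) s :=
      (hzcont.norm s hs).mono (hsub.trans Ioo_subset_Icc_self)
    exact (hzs.closure_le hcl continuousWithinAt_const hle).trans_lt hBR
  exact ⟨z, hz0, fun t ht => untruncate ht (hlt t (Ioo_subset_Icc_self ht))⟩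

theorem eqOn_Ioo_of_hasDerivAt
    (hlip : ∀ R : ℝ, ∃ K : ℝ≥0, ∀ t, LipschitzOnWith K (f t) (closedBall 0 R)) {T : ℝ}
    {z₁ z₂ : ℝ → E} (h₁ : ∀ t ∈ Ioo (-T) T, HasDerivAt z₁ (f t (z₁ t)) t)
    (h₂ : ∀ t ∈ Ioo (-T) T, HasDerivAt z₂ (f t (z₂ t)) t) (h0 : z₁ 0 = z₂ 0) :
    EqOn z₁ z₂ (Ioo (-T) T) := by
  intro t ht
  obtain ⟨S, htS, hST⟩ := exists_between (abs_lt.2 ht)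
  have hsub : Icc (-S) S ⊆ Ioo (-T) T := Icc_subset_Ioo (neg_lt_neg hST) hST
  have bounded {z : ℝ → E} (hz : ∀ t ∈ Ioo (-T) T, HasDerivAt z (f t (z t)) t) :
      ∃ R, ∀ s ∈ Icc (-S) S, ‖z s‖ ≤ R :=
    isCompact_Icc.exists_bound_of_continuousOn fun s hs =>
      (hz s (hsub hs)).continuousAt.continuousWithinAt
  obtain ⟨R₁, hR₁⟩ := bounded h₁
  obtain ⟨R₂, hR₂⟩ := bounded h₂
  obtain ⟨K, hK⟩ := hlip (max R₁ R₂)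
  have hS : 0 < S := (abs_nonneg t).trans_lt htS
  refine ODE_solution_unique_of_mem_Ioo (s := fun _ => closedBall 0 (max R₁ R₂))
    (fun s _ => hK s) (t₀ := 0) ⟨by linarith, hS⟩ (fun s hs => ?_) (fun s hs => ?_) h0
    (abs_lt.1 htS)
  all_goals replace hs := Ioo_subset_Icc_self hs
  · exact ⟨h₁ s (hsub hs), mem_closedBall_zero_iff.2 ((hR₁ s hs).trans (le_max_left _ _))⟩
  · exact ⟨h₂ s (hsub hs), mem_closedBall_zero_iff.2 ((hR₂ s hs).trans (le_max_right _ _))⟩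

theorem exists_forall_hasDerivAt [CompleteSpace E]
    (hlip : ∀ R : ℝ, ∃ K : ℝ≥0, ∀ t, LipschitzOnWith K (f t) (closedBall 0 R))
    (hcont : ∀ x, Continuous fun t => f t x) {x₀ : E}
    (hbound : ∀ T : ℝ, ∃ B : ℝ, ∀ S ≤ T, ∀ z : ℝ → E, z 0 = x₀ →
      (∀ t ∈ Ioo (-S) S, HasDerivAt z (f t (z t)) t) → ∀ t ∈ Ioo (-S) S, ‖z t‖ ≤ B) :
    ∃ z : ℝ → E, z 0 = x₀ ∧ ∀ t, HasDerivAt z (f t (z t)) t := by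
  have hex (T : ℝ) (hT : 0 < T) :
      ∃ z : ℝ → E, z 0 = x₀ ∧ ∀ t ∈ Ioo (-T) T, HasDerivAt z (f t (z t)) t :=
    (hbound T).elim fun _ hB => exists_hasDerivAt_Ioo hlip hcont hT hB
  choose! Z hZ0 hZ using hex
  have agree {S T : ℝ} (hS : 0 < S) (hST : S ≤ T) : EqOn (Z S) (Z T) (Ioo (-S) S) :=
    eqOn_Ioo_of_hasDerivAt hlip (hZ S hS)
      (fun t ht => hZ T (hS.trans_le hST) t (Ioo_subset_Ioo (neg_le_neg hST) hST ht))
      ((hZ0 S hS).trans (hZ0 T (hS.trans_le hST)).symm)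
  refine ⟨fun t => Z (|t| + 1) t, hZ0 _ (by positivity), fun t => ?_⟩
  have hev : (fun s => Z (|s| + 1) s) =ᶠ[𝓝 t] Z (|t| + 1 + 1) := by
    filter_upwards [(continuous_abs.tendsto t).eventually (gt_mem_nhds (lt_add_one |t|))] with s hs
    exact agree (by positivity) (by linarith) (abs_lt.1 (lt_add_one |s|))
  have hderiv := hZ (|t| + 1 + 1) (by positivity) t (abs_lt.1 (by linarith))
  rw [← hev.eq_of_nhds] at hderiv
  exact hderiv.congr_of_eventuallyEq hev

end ODE

/-- The effective potential `a |u|² + b |v|²` felt by the component `u`. -/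
def potential (a b : ℝ) (u v : H1) : H1 := (a : ℂ) • (u * star u) + (b : ℂ) • (v * star v)

theorem star_potential (a b : ℝ) (u v : H1) : star (potential a b u v) = potential a b u v := by
  rw [potential, star_add, star_smul, star_smul, star_mul_star, star_mul_star, Complex.star_def,
    Complex.conj_ofReal, Complex.conj_ofReal]

/-- The zeroth-order part `-i κ v + γ u + i (a |u|² + b |v|²) u` of `u_t`. -/
def forcing (κ γ a b : ℝ) (u v : H1) : H1 :=
  (-Complex.I * κ) • v + (γ : ℂ) • u + Complex.I • (u * potential a b u v)

theorem toHNeg1L_mul_potential (a b : ℝ) (u v φ : H1) :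
    toHNeg1L (u * potential a b u v) φ
      = ∫ x, ((a * ‖toL2 u x‖ ^ 2 + b * ‖toL2 v x‖ ^ 2 : ℝ) : ℂ) * toL2 u x * toL2 φ x := by
  rw [toHNeg1L_apply, pairL2_apply]
  apply integral_congr_ae
  have hpotential : toL2 (potential a b u v)
      = (a : ℂ) • toL2 (u * star u) + (b : ℂ) • toL2 (v * star v) := by
    rw [potential, map_add, map_smul, map_smul]
  filter_upwards [coeFn_toL2_mul u (potential a b u v), coeFn_toL2_mul u (star u),
    coeFn_toL2_mul v (star v), coeFn_toL2_star u, coeFn_toL2_star v,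
    Lp.coeFn_add ((a : ℂ) • toL2 (u * star u)) ((b : ℂ) • toL2 (v * star v)),
    Lp.coeFn_smul (a : ℂ) (toL2 (u * star u)), Lp.coeFn_smul (b : ℂ) (toL2 (v * star v))]
    with x hmul hu hv hu' hv' hadd ha hb
  rw [hmul, hpotential, hadd, Pi.add_apply, ha, hb, Pi.smul_apply, Pi.smul_apply, hu, hv, hu', hv',
    Complex.star_def, Complex.mul_conj', Complex.mul_conj']
  push_cast
  simp only [smul_eq_mul]
  ring

theorem rhs_eq (κ γ a b : ℝ) (u v φ : H1) :
    rhs κ γ a b u v φ = dirichletForm u φ + Complex.I * toHNeg1L (forcing κ γ a b u v) φ := by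
  simp only [rhs, ← toHNeg1L_mul_potential, forcing, map_add, map_smul, add_apply, smul_apply,
    smul_eq_mul, toHNeg1L_apply, dirichletForm_apply, pairL2_apply]
  linear_combination (κ * (∫ x, toL2 v x * toL2 φ x)
    - ∫ x, toL2 (u * potential a b u v) x * toL2 φ x) * Complex.I_sq

theorem forall_I_mul_eq_rhs_iff {κ γ a b : ℝ} {u v : H1} {L : HNeg1} :
    (∀ φ, Complex.I * L φ = rhs κ γ a b u v φ)
      ↔ L = schrodingerOp u + toHNeg1L (forcing κ γ a b u v) := by
  simp only [rhs_eq]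
  constructor
  · intro h
    ext φ
    rw [add_apply, schrodingerOp_apply]
    linear_combination -Complex.I * h φ
      + (L φ - toHNeg1L (forcing κ γ a b u v) φ) * Complex.I_sq
  · rintro rfl φ
    rw [add_apply, schrodingerOp_apply]
    linear_combination (-dirichletForm u φ) * Complex.I_sq

theorem isGlobalSolution_iff {κ γ g₁₁ g₂₂ g₁₂ : ℝ} {w : C(ℝ, H1 × H1)} :
    IsGlobalSolution κ γ g₁₁ g₂₂ g₁₂ w ↔
      (∀ t, HasDerivAt (fun s => toHNeg1L (w s).1)
        (schrodingerOp (w t).1 + toHNeg1L (forcing κ γ g₁₁ g₁₂ (w t).1 (w t).2)) t) ∧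
      ∀ t, HasDerivAt (fun s => toHNeg1L (w s).2)
        (schrodingerOp (w t).2 + toHNeg1L (forcing κ (-γ) g₂₂ g₁₂ (w t).2 (w t).1)) t := by
  refine ⟨fun h => ⟨fun t => ?_, fun t => ?_⟩, fun h => ⟨fun t => ?_, fun t => ?_⟩⟩
  · obtain ⟨ut, hderiv, heq⟩ := h.eq_u t
    exact hderiv.congr_deriv (forall_I_mul_eq_rhs_iff.1 heq)
  · obtain ⟨vt, hderiv, heq⟩ := h.eq_v t
    exact hderiv.congr_deriv (forall_I_mul_eq_rhs_iff.1 heq)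
  · exact ⟨_, h.1 t, forall_I_mul_eq_rhs_iff.2 rfl⟩
  · exact ⟨_, h.2 t, forall_I_mul_eq_rhs_iff.2 rfl⟩

section Lipschitz

variable {X : Type*} [PseudoMetricSpace X] {s : Set X} {F G : X → H1}

theorem exists_lipschitzOnWith_const_smul (c : ℂ) (hF : ∃ K, LipschitzOnWith K F s) :
    ∃ K, LipschitzOnWith K (fun x => c • F x) s :=
  hF.imp' (‖c‖₊ * ·) fun _ h => (lipschitzWith_smul c).comp_lipschitzOnWith h

theorem exists_lipschitzOnWith_add (hF : ∃ K, LipschitzOnWith K F s)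
    (hG : ∃ K, LipschitzOnWith K G s) : ∃ K, LipschitzOnWith K (fun x => F x + G x) s :=
  hF.elim fun _ hF => hG.elim fun _ hG => ⟨_, hF.add hG⟩

theorem exists_lipschitzOnWith_star (hF : ∃ K, LipschitzOnWith K F s) :
    ∃ K, LipschitzOnWith K (fun x => star (F x)) s :=
  hF.imp' (1 * ·) fun _ h => (starₗᵢ ℂ (E := H1)).lipschitz.comp_lipschitzOnWith h

theorem exists_lipschitzOnWith_mul (hs : Bornology.IsBounded s)
    (hF : ∃ K, LipschitzOnWith K F s) (hG : ∃ K, LipschitzOnWith K G s) :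
    ∃ K, LipschitzOnWith K (fun x => F x * G x) s := by
  have bounded {F : X → H1} (hF : ∃ K, LipschitzOnWith K F s) : ∃ M : ℝ≥0, ∀ x ∈ s, ‖F x‖ ≤ M := by
    obtain ⟨K, hK⟩ := hF
    obtain ⟨M, hM⟩ := (isBounded_image_iff.2 ⟨K * diam s, fun x hx y hy =>
      (hK.dist_le_mul x hx y hy).trans
        (by gcongr; exact dist_le_diam_of_mem hs hx hy)⟩).exists_norm_le
    exact ⟨M.toNNReal, fun x hx => (hM _ (mem_image_of_mem F hx)).trans (le_coe_toNNReal M)⟩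
  obtain ⟨M, hM⟩ := bounded hF
  obtain ⟨N, hN⟩ := bounded hG
  obtain ⟨K, hK⟩ := hF
  obtain ⟨L, hL⟩ := hG
  refine ⟨3 * M * L + 3 * N * K, LipschitzOnWith.of_dist_le_mul fun x hx y hy => ?_⟩
  have hsplit : F x * G x - F y * G y = F x * (G x - G y) + G y * (F x - F y) := by
    rw [mul_sub, mul_sub, mul_comm (G y), mul_comm (G y), sub_add_sub_cancel]
  calc dist (F x * G x) (F y * G y) = ‖F x * (G x - G y) + G y * (F x - F y)‖ := by
        rw [dist_eq_norm, hsplit]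
    _ ≤ 3 * ‖F x‖ * dist (G x) (G y) + 3 * ‖G y‖ * dist (F x) (F y) := by
        rw [dist_eq_norm, dist_eq_norm]
        exact norm_add_le_of_le (H1.norm_mul_le _ _) (H1.norm_mul_le _ _)
    _ ≤ 3 * M * (L * dist x y) + 3 * N * (K * dist x y) := by
        gcongr
        exacts [hM x hx, hL.dist_le_mul x hx y hy, hN y hy, hK.dist_le_mul x hx y hy]
    _ = (3 * M * L + 3 * N * K : ℝ≥0) * dist x y := by
        push_cast
        ring

theorem exists_lipschitzOnWith_forcing (hs : Bornology.IsBounded s)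
    (hF : ∃ K, LipschitzOnWith K F s) (hG : ∃ K, LipschitzOnWith K G s) (κ γ a b : ℝ) :
    ∃ K, LipschitzOnWith K (fun x => forcing κ γ a b (F x) (G x)) s :=
  have hpotential : ∃ K, LipschitzOnWith K (fun x => potential a b (F x) (G x)) s :=
    exists_lipschitzOnWith_add
      (exists_lipschitzOnWith_const_smul _
        (exists_lipschitzOnWith_mul hs hF (exists_lipschitzOnWith_star hF)))
      (exists_lipschitzOnWith_const_smul _
        (exists_lipschitzOnWith_mul hs hG (exists_lipschitzOnWith_star hG)))
  exists_lipschitzOnWith_add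
    (exists_lipschitzOnWith_add (exists_lipschitzOnWith_const_smul _ hG)
      (exists_lipschitzOnWith_const_smul _ hF))
    (exists_lipschitzOnWith_const_smul _ (exists_lipschitzOnWith_mul hs hF hpotential))

end Lipschitz

/-- The zeroth-order part of `(u_t, v_t)`, as a vector field on `H¹ × H¹`. -/
def forcingPair (κ γ g₁₁ g₂₂ g₁₂ : ℝ) (w : H1 × H1) : H1 × H1 :=
  (forcing κ γ g₁₁ g₁₂ w.1 w.2, forcing κ (-γ) g₂₂ g₁₂ w.2 w.1)

theorem exists_lipschitzOnWith_forcingPair (κ γ g₁₁ g₂₂ g₁₂ R : ℝ) :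
    ∃ K, LipschitzOnWith K (forcingPair κ γ g₁₁ g₂₂ g₁₂) (closedBall 0 R) := by
  have hfst : ∃ K, LipschitzOnWith K Prod.fst (closedBall (0 : H1 × H1) R) :=
    ⟨1, LipschitzWith.prod_fst.lipschitzOnWith⟩
  have hsnd : ∃ K, LipschitzOnWith K Prod.snd (closedBall (0 : H1 × H1) R) :=
    ⟨1, LipschitzWith.prod_snd.lipschitzOnWith⟩
  obtain ⟨K, hK⟩ := exists_lipschitzOnWith_forcing isBounded_closedBall hfst hsnd κ γ g₁₁ g₁₂
  obtain ⟨L, hL⟩ := exists_lipschitzOnWith_forcing isBounded_closedBall hsnd hfst κ (-γ) g₂₂ g₁₂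
  exact ⟨max K L, hK.prodMk hL⟩

theorem continuous_forcingPair (κ γ g₁₁ g₂₂ g₁₂ : ℝ) :
    Continuous (forcingPair κ γ g₁₁ g₂₂ g₁₂) := by
  unfold forcingPair forcing potential
  fun_prop

/-- The free Schrödinger group acting on both components. -/
def freePair (t : ℝ) (w : H1 × H1) : H1 × H1 := (free t w.1, free t w.2)

theorem freePair_zero (w : H1 × H1) : freePair 0 w = w := by
  rw [freePair, free_zero, free_zero]

theorem freePair_freePair_neg (t : ℝ) (w : H1 × H1) : freePair t (freePair (-t) w) = w := by
  rw [freePair, freePair, free_free_neg, free_free_neg]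

theorem norm_freePair (t : ℝ) (w : H1 × H1) : ‖freePair t w‖ = ‖w‖ := by
  rw [freePair, Prod.norm_mk, LinearIsometry.norm_map, LinearIsometry.norm_map, Prod.norm_def]

theorem lipschitzWith_freePair (t : ℝ) : LipschitzWith 1 (freePair t) := by
  have h := ((free t).lipschitz.comp LipschitzWith.prod_fst).prodMk
    ((free t).lipschitz.comp LipschitzWith.prod_snd)
  rwa [one_mul, max_self] at h

theorem continuous_freePair : Continuous fun p : ℝ × (H1 × H1) => freePair p.1 p.2 :=
  continuous_prod_of_continuous_lipschitzWith' _ 1 lipschitzWith_freePair fun w =>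
    (continuous_free_left w.1).prodMk (continuous_free_left w.2)

/-- The vector field of the system in the interaction picture, where `w` is replaced by
`freePair (-t) w`. -/
def interactionField (κ γ g₁₁ g₂₂ g₁₂ t : ℝ) (z : H1 × H1) : H1 × H1 :=
  freePair (-t) (forcingPair κ γ g₁₁ g₂₂ g₁₂ (freePair t z))

theorem exists_lipschitzOnWith_interactionField (κ γ g₁₁ g₂₂ g₁₂ R : ℝ) :
    ∃ K, ∀ t, LipschitzOnWith K (interactionField κ γ g₁₁ g₂₂ g₁₂ t) (closedBall 0 R) := by
  obtain ⟨K, hK⟩ := exists_lipschitzOnWith_forcingPair κ γ g₁₁ g₂₂ g₁₂ R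
  refine ⟨1 * (K * 1), fun t => (lipschitzWith_freePair (-t)).comp_lipschitzOnWith
    (hK.comp (lipschitzWith_freePair t).lipschitzOnWith fun z hz => ?_)⟩
  rwa [mem_closedBall_zero_iff, norm_freePair, ← mem_closedBall_zero_iff]

theorem continuous_interactionField (κ γ g₁₁ g₂₂ g₁₂ : ℝ) (z : H1 × H1) :
    Continuous fun t => interactionField κ γ g₁₁ g₂₂ g₁₂ t z := by
  have hfree : Continuous fun t => freePair t z :=
    continuous_freePair.comp₂ continuous_id continuous_const
  exact continuous_freePair.comp₂ continuous_neg
    ((continuous_forcingPair κ γ g₁₁ g₂₂ g₁₂).comp hfree)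

theorem hasDerivAt_clm_apply_sub {X Y Z : Type*} [NormedAddCommGroup X] [NormedSpace ℂ X]
    [NormedAddCommGroup Y] [NormedSpace ℂ Y] [NormedAddCommGroup Z] [NormedSpace ℂ Z]
    (B : X →L[ℂ] Y →L[ℂ] Z) {x : ℝ → X} {x' : X} {y : ℝ → Y} {t : ℝ} (hx : HasDerivAt x x' t)
    (hy : ContinuousAt y t) : HasDerivAt (fun s => B (x s - x t) (y s)) (B x' (y t)) t := by
  rw [hasDerivAt_iff_tendsto_slope] at hx ⊢
  have hlim : Tendsto (fun s => B (slope x t s) (y s)) (𝓝[≠] t) (𝓝 (B x' (y t))) :=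
    (isBoundedBilinearMap_apply.continuous.tendsto (B x', y t)).comp
      (((B.continuous.tendsto x').comp hx).prodMk_nhds
        (hy.tendsto.mono_left nhdsWithin_le_nhds))
  refine hlim.congr fun s => ?_
  rw [slope_def_module, slope_def_module, sub_self, map_zero, zero_apply, sub_zero,
    ← Complex.coe_smul, ← Complex.coe_smul, map_smul, smul_apply]

theorem hasDerivAt_toHNeg1L_apply {f g : ℝ → H1} {f' g' : HNeg1} {t : ℝ}
    (hf : HasDerivAt (fun s => toHNeg1L (f s)) f' t)
    (hg : HasDerivAt (fun s => toHNeg1L (g s)) g' t) (hcont : ContinuousAt g t) :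
    HasDerivAt (fun s => toHNeg1L (f s) (g s)) (f' (g t) + g' (f t)) t := by
  have hleft := hasDerivAt_clm_apply_sub (ContinuousLinearMap.id ℂ HNeg1) hf hcont
  have hright := hasDerivAt_clm_apply_sub (ContinuousLinearMap.id ℂ HNeg1) hg
    (continuousAt_const (y := f t))
  refine ((hleft.add hright).add_const (toHNeg1L (g t) (f t))).congr_of_eventuallyEq
    (Eventually.of_forall fun s => ?_)
  simp only [ContinuousLinearMap.id_apply, sub_apply, Pi.add_apply, toHNeg1L_comm (g s) (f t)]
  ring

theorem hasDerivAt_toHNeg1L_mul {f g : ℝ → H1} {f' g' : HNeg1} {t : ℝ}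
    (hf : HasDerivAt (fun s => toHNeg1L (f s)) f' t)
    (hg : HasDerivAt (fun s => toHNeg1L (g s)) g' t) (hcont : ContinuousAt g t) :
    HasDerivAt (fun s => toHNeg1L (f s * g s)) (f' ∘L mulCLM (g t) + g' ∘L mulCLM (f t)) t := by
  have hleft := hasDerivAt_clm_apply_sub (ContinuousLinearMap.compL ℂ H1 H1 ℂ) hf
    (mulCLM.continuous.continuousAt.comp hcont)
  have hright := hasDerivAt_clm_apply_sub (ContinuousLinearMap.compL ℂ H1 H1 ℂ) hg
    (continuousAt_const (y := mulCLM (f t)))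
  refine ((hleft.add hright).add_const (toHNeg1L (g t * f t))).congr_of_eventuallyEq
    (Eventually.of_forall fun s => ?_)
  ext φ
  simp only [ContinuousLinearMap.compL_apply, Function.comp_apply, Pi.add_apply, add_apply,
    ContinuousLinearMap.comp_apply, sub_apply, ← H1.mul_def, ← toHNeg1L_mul, mul_comm (g s) (f t)]
  ring

/-- Complex conjugation `L ↦ (φ ↦ conj (L (conj φ)))` on `H⁻¹`, needed to differentiate `|u|²`. -/
def conjDual : HNeg1 →L[ℝ] HNeg1 :=
  LinearMap.mkContinuous
    { toFun := fun L => (starL ℂ : ℂ ≃L⋆[ℂ] ℂ).toContinuousLinearMap.comp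
        (L.comp (starL ℂ : H1 ≃L⋆[ℂ] H1).toContinuousLinearMap)
      map_add' := fun L M => by ext φ; simp
      map_smul' := fun c L => by ext φ; simp }
    1 fun L => by
      rw [one_mul]
      refine ContinuousLinearMap.opNorm_le_bound _ (norm_nonneg _) fun φ => ?_
      change ‖star (L (star φ))‖ ≤ _
      rw [norm_star, ← norm_star φ]
      exact L.le_opNorm _

theorem conjDual_apply (L : HNeg1) (φ : H1) : conjDual L φ = star (L (star φ)) := rfl

theorem conjDual_toHNeg1L (f : H1) : conjDual (toHNeg1L f) = toHNeg1L (star f) := by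
  ext φ
  rw [conjDual_apply, star_toHNeg1L, star_star]

theorem conjDual_schrodingerOp_apply (f g : H1) :
    conjDual (schrodingerOp f) g = -schrodingerOp g (star f) := by
  rw [conjDual_apply, schrodingerOp_apply, star_mul', star_dirichletForm, star_star,
    dirichletForm_comm, schrodingerOp_apply]
  simp

theorem hasDerivAt_toHNeg1L_star {f : ℝ → H1} {f' : HNeg1} {t : ℝ}
    (hf : HasDerivAt (fun s => toHNeg1L (f s)) f' t) :
    HasDerivAt (fun s => toHNeg1L (star (f s))) (conjDual f') t := by
  simp_rw [← conjDual_toHNeg1L]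
  exact conjDual.hasFDerivAt.comp_hasDerivAt t hf

section Duhamel

variable {u : ℝ → H1} {t : ℝ}

theorem inner_toL2_free_neg (t : ℝ) (φ f : H1) :
    inner ℂ (toL2 φ) (toL2 (free (-t) f)) = toHNeg1L f (star (free t φ)) := by
  rw [toHNeg1L_comm, toHNeg1L_star, ← (freeL2 t).inner_map_map, ← toL2_free, ← toL2_free,
    free_free_neg]

theorem hasDerivAt_toHNeg1L {F : H1}
    (hu : HasDerivAt (fun s => free (-s) (u s)) (free (-t) F) t) :
    HasDerivAt (fun s => toHNeg1L (u s)) (schrodingerOp (u t) + toHNeg1L F) t := by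
  simpa only [free_free_neg] using hasDerivAt_toHNeg1L_free_comp hu

theorem hasDerivAt_free_neg {F : ℝ → H1} (hF : Continuous F)
    (h : ∀ t, HasDerivAt (fun s => toHNeg1L (u s)) (schrodingerOp (u t) + toHNeg1L (F t)) t)
    (t : ℝ) : HasDerivAt (fun s => free (-s) (u s)) (free (-t) (F t)) t := by
  refine hasDerivAt_of_forall_apply
    (fun φ : H1 => (innerSL ℂ (toL2 φ) ∘L toL2).restrictScalars ℝ)
    (fun f g h => ?_) (g' := fun t => free (-t) (F t))
    (continuous_free.comp₂ continuous_neg hF) (fun φ t => ?_) t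
  · have hdiff : inner ℂ (toL2 (f - g)) (toL2 (f - g)) = 0 := by
      rw [map_sub toL2, inner_sub_right, sub_eq_zero, ← map_sub]
      exact h (f - g)
    rw [inner_self_eq_zero, map_sub, sub_eq_zero] at hdiff
    exact toL2_injective hdiff
  · have hstar := hasDerivAt_toHNeg1L_star (hasDerivAt_toHNeg1L_free φ t)
    refine ((hasDerivAt_toHNeg1L_apply (h t) hstar
      (continuous_free_left φ).star.continuousAt).congr_deriv ?_).congr_of_eventuallyEq
      (Eventually.of_forall fun s => inner_toL2_free_neg s φ (u s))
    rw [conjDual_schrodingerOp_apply, add_apply, add_neg_cancel_comm]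
    exact (inner_toL2_free_neg t φ (F t)).symm

theorem continuousAt_of_free_neg (hu : ContinuousAt (fun s => free (-s) (u s)) t) :
    ContinuousAt u t := by
  simpa only [Function.comp_def, id, free_free_neg] using
    continuous_free.continuousAt.comp (continuousAt_id.prodMk hu)

end Duhamel

/-- The function `w` satisfies the system at time `t` in the interaction picture: the derivative of
`freePair (-s) w(s)` exists in `H¹` and only involves the zeroth-order terms. -/
def IsMildSolutionAt (κ γ g₁₁ g₂₂ g₁₂ : ℝ) (w : ℝ → H1 × H1) (t : ℝ) : Prop :=
  HasDerivAt (fun s => freePair (-s) (w s)) (freePair (-t) (forcingPair κ γ g₁₁ g₂₂ g₁₂ (w t))) t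

section IsMildSolutionAt

variable {κ γ g₁₁ g₂₂ g₁₂ : ℝ} {t : ℝ}

theorem isMildSolutionAt_freePair_iff {z : ℝ → H1 × H1} :
    IsMildSolutionAt κ γ g₁₁ g₂₂ g₁₂ (fun s => freePair s (z s)) t ↔
      HasDerivAt z (interactionField κ γ g₁₁ g₂₂ g₁₂ t (z t)) t := by
  have hcancel (s : ℝ) : freePair (-s) (freePair s (z s)) = z s := by
    simpa only [neg_neg] using freePair_freePair_neg (-s) (z s)
  simp only [IsMildSolutionAt, hcancel, interactionField]

theorem IsMildSolutionAt.hasDerivAt_fst {w : ℝ → H1 × H1}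
    (hw : IsMildSolutionAt κ γ g₁₁ g₂₂ g₁₂ w t) :
    HasDerivAt (fun s => free (-s) (w s).1)
      (free (-t) (forcing κ γ g₁₁ g₁₂ (w t).1 (w t).2)) t := hw.fst

theorem IsMildSolutionAt.hasDerivAt_snd {w : ℝ → H1 × H1}
    (hw : IsMildSolutionAt κ γ g₁₁ g₂₂ g₁₂ w t) :
    HasDerivAt (fun s => free (-s) (w s).2)
      (free (-t) (forcing κ (-γ) g₂₂ g₁₂ (w t).2 (w t).1)) t := hw.snd

theorem isGlobalSolution_iff_isMildSolutionAt {w : C(ℝ, H1 × H1)} :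
    IsGlobalSolution κ γ g₁₁ g₂₂ g₁₂ w ↔ ∀ t, IsMildSolutionAt κ γ g₁₁ g₂₂ g₁₂ w t := by
  have hforcing : Continuous fun t => forcingPair κ γ g₁₁ g₂₂ g₁₂ (w t) :=
    (continuous_forcingPair κ γ g₁₁ g₂₂ g₁₂).comp w.continuous
  rw [isGlobalSolution_iff]
  refine ⟨fun h t => HasDerivAt.prodMk ?_ ?_, fun h => ⟨fun t => ?_, fun t => ?_⟩⟩
  · exact hasDerivAt_free_neg hforcing.fst h.1 t
  · exact hasDerivAt_free_neg hforcing.snd h.2 t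
  · exact hasDerivAt_toHNeg1L (h t).hasDerivAt_fst
  · exact hasDerivAt_toHNeg1L (h t).hasDerivAt_snd

theorem IsGlobalSolution.eq_of_apply_zero_eq {w₁ w₂ : C(ℝ, H1 × H1)}
    (h₁ : IsGlobalSolution κ γ g₁₁ g₂₂ g₁₂ w₁) (h₂ : IsGlobalSolution κ γ g₁₁ g₂₂ g₁₂ w₂)
    (h0 : w₁ 0 = w₂ 0) : w₁ = w₂ := by
  have hode {w : C(ℝ, H1 × H1)} (hw : IsGlobalSolution κ γ g₁₁ g₂₂ g₁₂ w) (t : ℝ) :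
      HasDerivAt (fun s => freePair (-s) (w s))
        (interactionField κ γ g₁₁ g₂₂ g₁₂ t (freePair (-t) (w t))) t := by
    rw [interactionField, freePair_freePair_neg]
    exact isGlobalSolution_iff_isMildSolutionAt.1 hw t
  ext1 t
  have heq := eqOn_Ioo_of_hasDerivAt (T := |t| + 1)
    (exists_lipschitzOnWith_interactionField κ γ g₁₁ g₂₂ g₁₂) (fun s _ => hode h₁ s)
    (fun s _ => hode h₂ s) (by rw [h0]) (abs_lt.1 (lt_add_one |t|))
  rw [← freePair_freePair_neg t (w₁ t), ← freePair_freePair_neg t (w₂ t)]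
  exact congrArg (freePair t) heq

end IsMildSolutionAt

section Pairing

variable {q d : ℝ} {f g h k u v : H1} {a b : ℝ}

theorem norm_toHNeg1L_apply_le (f g : H1) : ‖toHNeg1L f g‖ ≤ ‖toL2 f‖ * ‖toL2 g‖ := by
  rw [← star_star f, toHNeg1L_star, star_star, ← norm_conjL2 (toL2 f), ← toL2_star]
  exact norm_inner_le_norm _ _

theorem norm_toL2_mul_le_sqrt (hf : ‖toL2 f‖ ≤ q) (hf' : ‖dx f‖ ≤ d) (hg : ‖toL2 g‖ ≤ q) :
    ‖toL2 (f * g)‖ ≤ √(2 * q * d) * q := by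
  have hq : 0 ≤ q := (norm_nonneg _).trans hf
  have hLinf : ‖toLinf f‖ ≤ √(2 * q * d) :=
    Real.le_sqrt_of_sq_le ((norm_toLinf_sq_le f).trans (by gcongr))
  exact (norm_toL2_mul_le f g).trans (by gcongr)

theorem norm_toHNeg1L_mul_mul_le (hf : ‖toL2 f‖ ≤ q) (hf' : ‖dx f‖ ≤ d) (hg : ‖toL2 g‖ ≤ q)
    (hh : ‖toL2 h‖ ≤ q) (hh' : ‖dx h‖ ≤ d) (hk : ‖toL2 k‖ ≤ q) :
    ‖toHNeg1L (f * g) (h * k)‖ ≤ 2 * q ^ 3 * d := by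
  have hq : 0 ≤ q := (norm_nonneg _).trans hf
  have hd : 0 ≤ d := (norm_nonneg _).trans hf'
  calc ‖toHNeg1L (f * g) (h * k)‖ ≤ ‖toL2 (f * g)‖ * ‖toL2 (h * k)‖ := norm_toHNeg1L_apply_le _ _
    _ ≤ √(2 * q * d) * q * (√(2 * q * d) * q) := by
        gcongr
        exacts [norm_toL2_mul_le_sqrt hf hf' hg, norm_toL2_mul_le_sqrt hh hh' hk]
    _ = √(2 * q * d) ^ 2 * q ^ 2 := by ring
    _ = 2 * q ^ 3 * d := by
        rw [Real.sq_sqrt (by positivity)]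
        ring

theorem norm_toL2_star (f : H1) : ‖toL2 (star f)‖ = ‖toL2 f‖ := by rw [toL2_star, norm_conjL2]

theorem norm_dx_star (f : H1) : ‖dx (star f)‖ = ‖dx f‖ := by rw [dx_star, norm_conjL2]

theorem norm_toHNeg1L_star_mul_potential_le (hu : ‖toL2 u‖ ≤ q) (hu' : ‖dx u‖ ≤ d)
    (hv : ‖toL2 v‖ ≤ q) (hv' : ‖dx v‖ ≤ d) (hf : ‖toL2 f‖ ≤ q) :
    ‖toHNeg1L f (star u * potential a b u v)‖ ≤ (|a| + |b|) * (2 * q ^ 3 * d) := by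
  have hstar : ‖toL2 (star u)‖ ≤ q := (norm_toL2_star u).trans_le hu
  have hstar' : ‖dx (star u)‖ ≤ d := (norm_dx_star u).trans_le hu'
  have hstar_v : ‖toL2 (star v)‖ ≤ q := (norm_toL2_star v).trans_le hv
  rw [← toHNeg1L_mul, mul_comm f, potential, map_add, map_smul, map_smul, smul_eq_mul, smul_eq_mul]
  refine (norm_add_le _ _).trans ?_
  rw [norm_mul, norm_mul, Complex.norm_real, Complex.norm_real, Real.norm_eq_abs,
    Real.norm_eq_abs, add_mul]
  gcongr
  exacts [norm_toHNeg1L_mul_mul_le hstar hstar' hf hu hu' hstar,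
    norm_toHNeg1L_mul_mul_le hstar hstar' hf hv hv' hstar_v]

theorem toHNeg1L_apply_star_self (f : H1) : toHNeg1L f (star f) = ((‖toL2 f‖ ^ 2 : ℝ) : ℂ) := by
  rw [toHNeg1L_comm, toHNeg1L_star, inner_self_eq_norm_sq_to_K]
  norm_cast

theorem re_toHNeg1L_forcing (κ γ a b : ℝ) (u v : H1) :
    (toHNeg1L (forcing κ γ a b u v) (star u * potential a b u v)).re
      = (-Complex.I * κ * toHNeg1L v (star u * potential a b u v)).re
        + γ * (toHNeg1L u (star u * potential a b u v)).re := by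
  have hreal : (toHNeg1L (u * potential a b u v) (star u * potential a b u v)).im = 0 := by
    have h := toHNeg1L_apply_star_self (u * potential a b u v)
    rw [star_mul', star_potential] at h
    rw [h, Complex.ofReal_im]
  simp only [forcing, map_add, map_smul, add_apply, smul_apply, smul_eq_mul, Complex.add_re,
    Complex.re_ofReal_mul, Complex.I_mul_re, hreal, neg_zero, add_zero]

theorem abs_re_toHNeg1L_forcing_le {κ γ : ℝ} (hu : ‖toL2 u‖ ≤ q) (hu' : ‖dx u‖ ≤ d)
    (hv : ‖toL2 v‖ ≤ q) (hv' : ‖dx v‖ ≤ d) :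
    |(toHNeg1L (forcing κ γ a b u v) (star u * potential a b u v)).re|
      ≤ (|κ| + |γ|) * ((|a| + |b|) * (2 * q ^ 3 * d)) := by
  have hcross : |(-Complex.I * κ * toHNeg1L v (star u * potential a b u v)).re|
      ≤ |κ| * ((|a| + |b|) * (2 * q ^ 3 * d)) := by
    refine (Complex.abs_re_le_norm _).trans ?_
    rw [norm_mul, norm_mul, norm_neg, Complex.norm_I, one_mul, Complex.norm_real,
      Real.norm_eq_abs]
    gcongr
    exact norm_toHNeg1L_star_mul_potential_le hu hu' hv hv' hv
  have hself : |γ * (toHNeg1L u (star u * potential a b u v)).re|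
      ≤ |γ| * ((|a| + |b|) * (2 * q ^ 3 * d)) := by
    rw [abs_mul]
    gcongr
    exact (Complex.abs_re_le_norm _).trans (norm_toHNeg1L_star_mul_potential_le hu hu' hv hv' hu)
  rw [re_toHNeg1L_forcing, add_mul]
  exact (abs_add_le _ _).trans (add_le_add hcross hself)

theorem re_inner_forcing_add_forcing {E : Type*} [NormedAddCommGroup E] [InnerProductSpace ℂ E]
    (T : H1 →L[ℂ] E) (κ γ g₁₁ g₂₂ g₁₂ : ℝ) (u v : H1) :
    (inner ℂ (T u) (T (forcing κ γ g₁₁ g₁₂ u v))).re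
        + (inner ℂ (T v) (T (forcing κ (-γ) g₂₂ g₁₂ v u))).re
      = γ * (‖T u‖ ^ 2 - ‖T v‖ ^ 2) - (inner ℂ (T u) (T (u * potential g₁₁ g₁₂ u v))).im
        - (inner ℂ (T v) (T (v * potential g₂₂ g₁₂ v u))).im := by
  have hcross : (inner ℂ (T u) (T v)).im + (inner ℂ (T v) (T u)).im = 0 := by
    rw [← inner_conj_symm (T u), Complex.conj_im, neg_add_cancel]
  have hself (f : H1) : inner ℂ (T f) (T f) = ((‖T f‖ ^ 2 : ℝ) : ℂ) := by
    rw [inner_self_eq_norm_sq_to_K]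
    norm_cast
  simp only [forcing, map_add, map_smul, inner_add_right, inner_smul_right, hself, Complex.add_re,
    neg_mul, mul_assoc, Complex.neg_re, Complex.I_mul_re, Complex.im_ofReal_mul,
    Complex.re_ofReal_mul, Complex.ofReal_re]
  linear_combination κ * hcross

theorem im_inner_toL2_mul_potential (a b : ℝ) (u v : H1) :
    (inner ℂ (toL2 u) (toL2 (u * potential a b u v))).im = 0 := by
  rw [← toHNeg1L_star, ← Complex.conj_eq_iff_im, ← Complex.star_def, star_toHNeg1L, star_mul',
    star_potential, star_star, ← toHNeg1L_mul, ← toHNeg1L_mul, mul_comm u]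

theorem re_schrodingerOp_star_mul_potential (a b : ℝ) (u v : H1) :
    (schrodingerOp u (star u * potential a b u v)).re
      = -(inner ℂ (dx u) (dx (u * potential a b u v))).im := by
  rw [← dirichletForm_star, schrodingerOp_apply, ← Complex.conj_im, ← Complex.star_def,
    star_dirichletForm, star_star, star_mul', star_potential]
  simp

end Pairing

/-- The total mass `‖u‖² + ‖v‖²`. -/
def mass (w : H1 × H1) : ℝ := ‖toL2 w.1‖ ^ 2 + ‖toL2 w.2‖ ^ 2

/-- The kinetic energy `‖uₓ‖² + ‖vₓ‖²`. -/
def kinetic (w : H1 × H1) : ℝ := ‖dx w.1‖ ^ 2 + ‖dx w.2‖ ^ 2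

/-- The quartic part `∫ ½ g₁₁ |u|⁴ + ½ g₂₂ |v|⁴ + g₁₂ |u|² |v|²` of the energy. -/
def quartic (g₁₁ g₂₂ g₁₂ : ℝ) (w : H1 × H1) : ℝ :=
  g₁₁ / 2 * (toHNeg1L (w.1 * star w.1) (w.1 * star w.1)).re
    + g₂₂ / 2 * (toHNeg1L (w.2 * star w.2) (w.2 * star w.2)).re
    + g₁₂ * (toHNeg1L (w.1 * star w.1) (w.2 * star w.2)).re

/-- The Hamiltonian of the system without linear coupling, `κ = γ = 0`. -/
def hamiltonian (g₁₁ g₂₂ g₁₂ : ℝ) (w : H1 × H1) : ℝ := kinetic w - quartic g₁₁ g₂₂ g₁₂ w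

/-- The strength `|g₁₁| + |g₂₂| + |g₁₂|` of the nonlinearity. -/
def coupling (g₁₁ g₂₂ g₁₂ : ℝ) : ℝ := |g₁₁| + |g₂₂| + |g₁₂|

/-- The Hamiltonian corrected by powers of the mass so as to control the squared `H¹` norm. -/
def energy (g₁₁ g₂₂ g₁₂ : ℝ) (w : H1 × H1) : ℝ :=
  hamiltonian g₁₁ g₂₂ g₁₂ w + mass w + (2 * coupling g₁₁ g₂₂ g₁₂ ^ 2 + 1) * mass w ^ 3

/-- The Gagliardo–Nirenberg bound `2 (‖u‖² + ‖v‖²)^(3/2) (‖uₓ‖² + ‖vₓ‖²)^(1/2)` for the integral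
of a product of four components of `w`. -/
def quarticBound (w : H1 × H1) : ℝ := 2 * √(mass w) ^ 3 * √(kinetic w)

section Coercivity

variable {g₁₁ g₂₂ g₁₂ : ℝ} (w : H1 × H1)

theorem mass_nonneg : 0 ≤ mass w := by
  unfold mass
  positivity

theorem kinetic_nonneg : 0 ≤ kinetic w := by
  unfold kinetic
  positivity

theorem coupling_nonneg (g₁₁ g₂₂ g₁₂ : ℝ) : 0 ≤ coupling g₁₁ g₂₂ g₁₂ := by
  unfold coupling
  positivity

theorem quarticBound_nonneg : 0 ≤ quarticBound w := by
  unfold quarticBound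
  positivity

theorem norm_toL2_fst_le_sqrt_mass : ‖toL2 w.1‖ ≤ √(mass w) :=
  Real.le_sqrt_of_sq_le (le_add_of_nonneg_right (sq_nonneg _))

theorem norm_toL2_snd_le_sqrt_mass : ‖toL2 w.2‖ ≤ √(mass w) :=
  Real.le_sqrt_of_sq_le (le_add_of_nonneg_left (sq_nonneg _))

theorem norm_dx_fst_le_sqrt_kinetic : ‖dx w.1‖ ≤ √(kinetic w) :=
  Real.le_sqrt_of_sq_le (le_add_of_nonneg_right (sq_nonneg _))

theorem norm_dx_snd_le_sqrt_kinetic : ‖dx w.2‖ ≤ √(kinetic w) :=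
  Real.le_sqrt_of_sq_le (le_add_of_nonneg_left (sq_nonneg _))

theorem abs_re_toHNeg1L_density_le {q d : ℝ} {u v : H1} (hu : ‖toL2 u‖ ≤ q) (hu' : ‖dx u‖ ≤ d)
    (hv : ‖toL2 v‖ ≤ q) (hv' : ‖dx v‖ ≤ d) :
    |(toHNeg1L (u * star u) (v * star v)).re| ≤ 2 * q ^ 3 * d :=
  (Complex.abs_re_le_norm _).trans (norm_toHNeg1L_mul_mul_le hu hu' ((norm_toL2_star u).trans_le hu)
    hv hv' ((norm_toL2_star v).trans_le hv))

theorem quartic_le : quartic g₁₁ g₂₂ g₁₂ w ≤ coupling g₁₁ g₂₂ g₁₂ * quarticBound w := by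
  have hu := norm_toL2_fst_le_sqrt_mass w
  have hv := norm_toL2_snd_le_sqrt_mass w
  have hu' := norm_dx_fst_le_sqrt_kinetic w
  have hv' := norm_dx_snd_le_sqrt_kinetic w
  have hmul (g x : ℝ) (hx : |x| ≤ quarticBound w) : g * x ≤ |g| * quarticBound w :=
    (le_abs_self _).trans ((abs_mul g x).trans_le (by gcongr))
  have h₁₁ := hmul (g₁₁ / 2) _ (abs_re_toHNeg1L_density_le hu hu' hu hu')
  have h₂₂ := hmul (g₂₂ / 2) _ (abs_re_toHNeg1L_density_le hv hv' hv hv')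
  have h₁₂ := hmul g₁₂ _ (abs_re_toHNeg1L_density_le hu hu' hv hv')
  rw [abs_div, abs_two] at h₁₁ h₂₂
  have hnonneg (g : ℝ) : 0 ≤ |g| * quarticBound w :=
    mul_nonneg (abs_nonneg g) (quarticBound_nonneg w)
  rw [quartic, coupling]
  linarith [hnonneg g₁₁, hnonneg g₂₂]

theorem mul_quarticBound_le (c : ℝ) :
    c * quarticBound w ≤ kinetic w / 2 + 2 * c ^ 2 * mass w ^ 3 := by
  have hyoung := sq_nonneg (√(kinetic w) - 2 * c * √(mass w) ^ 3)
  have hkinetic := Real.sq_sqrt (kinetic_nonneg w)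
  have hmass : (√(mass w) ^ 3) ^ 2 = mass w ^ 3 := by
    rw [← pow_mul, mul_comm, pow_mul, Real.sq_sqrt (mass_nonneg w)]
  rw [quarticBound]
  linear_combination hyoung / 2 + hkinetic / 2 + 2 * c ^ 2 * hmass

theorem add_le_energy : mass w + kinetic w / 2 + mass w ^ 3 ≤ energy g₁₁ g₂₂ g₁₂ w := by
  rw [energy, hamiltonian]
  linarith [quartic_le (g₁₁ := g₁₁) (g₂₂ := g₂₂) (g₁₂ := g₁₂) w,
    mul_quarticBound_le w (coupling g₁₁ g₂₂ g₁₂)]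

theorem quarticBound_le_two_mul_energy : quarticBound w ≤ 2 * energy g₁₁ g₂₂ g₁₂ w := by
  linarith [mul_quarticBound_le w 1, add_le_energy (g₁₁ := g₁₁) (g₂₂ := g₂₂) (g₁₂ := g₁₂) w,
    mass_nonneg w, kinetic_nonneg w]

theorem norm_sq_le_two_mul_energy : ‖w‖ ^ 2 ≤ 2 * energy g₁₁ g₂₂ g₁₂ w := by
  have hnorm : ‖w‖ ^ 2 ≤ ‖w.1‖ ^ 2 + ‖w.2‖ ^ 2 := by
    rcases max_choice ‖w.1‖ ‖w.2‖ with h | h <;> rw [Prod.norm_def, h]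
    exacts [le_add_of_nonneg_right (sq_nonneg _), le_add_of_nonneg_left (sq_nonneg _)]
  have hsum : ‖w.1‖ ^ 2 + ‖w.2‖ ^ 2 = mass w + kinetic w := by
    rw [H1.norm_sq_eq, H1.norm_sq_eq, mass, kinetic]
    ring
  linarith [add_le_energy (g₁₁ := g₁₁) (g₂₂ := g₂₂) (g₁₂ := g₁₂) w, mass_nonneg w,
    pow_nonneg (mass_nonneg w) 3]

theorem energy_nonneg : 0 ≤ energy g₁₁ g₂₂ g₁₂ w := by
  linarith [norm_sq_le_two_mul_energy (g₁₁ := g₁₁) (g₂₂ := g₂₂) (g₁₂ := g₁₂) w, sq_nonneg ‖w‖]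

end Coercivity

section Derivatives

variable {κ γ g₁₁ g₂₂ g₁₂ : ℝ} {w : ℝ → H1 × H1} {t : ℝ}

theorem hasDerivAt_norm_sq_of_free_comm {T : H1 →L[ℂ] L2} {u : ℝ → H1} {F : H1}
    (hT : ∀ s f, T (free s f) = freeL2 s (T f))
    (hu : HasDerivAt (fun s => free (-s) (u s)) (free (-t) F) t) :
    HasDerivAt (fun s => ‖T (u s)‖ ^ 2) (2 * (inner ℂ (T (u t)) (T F)).re) t := by
  have hTu : HasDerivAt (fun s => freeL2 (-s) (T (u s))) (freeL2 (-t) (T F)) t := by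
    simp_rw [← hT]
    exact (T.restrictScalars ℝ).hasFDerivAt.comp_hasDerivAt t hu
  have hnorm : (fun s => ‖T (u s)‖ ^ 2)
      = fun s => (inner ℂ (freeL2 (-s) (T (u s))) (freeL2 (-s) (T (u s)))).re := by
    funext s
    rw [LinearIsometry.inner_map_map, inner_self_eq_norm_sq_to_K]
    norm_cast
  rw [hnorm]
  refine (Complex.reCLM.hasFDerivAt.comp_hasDerivAt t (hTu.inner ℂ hTu)).congr_deriv ?_
  have hsymm : (inner ℂ (T F) (T (u t))).re = (inner ℂ (T (u t)) (T F)).re :=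
    inner_re_symm (𝕜 := ℂ) _ _
  rw [LinearIsometry.inner_map_map, LinearIsometry.inner_map_map, Complex.reCLM_apply,
    Complex.add_re, hsymm, two_mul]

theorem hasDerivAt_mass (hw : IsMildSolutionAt κ γ g₁₁ g₂₂ g₁₂ w t) :
    HasDerivAt (fun s => mass (w s)) (2 * γ * (‖toL2 (w t).1‖ ^ 2 - ‖toL2 (w t).2‖ ^ 2)) t := by
  refine ((hasDerivAt_norm_sq_of_free_comm toL2_free hw.hasDerivAt_fst).add
    (hasDerivAt_norm_sq_of_free_comm toL2_free hw.hasDerivAt_snd)).congr_deriv ?_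
  rw [← mul_add, re_inner_forcing_add_forcing, im_inner_toL2_mul_potential,
    im_inner_toL2_mul_potential]
  ring

theorem hasDerivAt_kinetic (hw : IsMildSolutionAt κ γ g₁₁ g₂₂ g₁₂ w t) :
    HasDerivAt (fun s => kinetic (w s))
      (2 * (γ * (‖dx (w t).1‖ ^ 2 - ‖dx (w t).2‖ ^ 2)
        - (inner ℂ (dx (w t).1) (dx ((w t).1 * potential g₁₁ g₁₂ (w t).1 (w t).2))).im
        - (inner ℂ (dx (w t).2) (dx ((w t).2 * potential g₂₂ g₁₂ (w t).2 (w t).1))).im)) t := by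
  refine ((hasDerivAt_norm_sq_of_free_comm dx_free hw.hasDerivAt_fst).add
    (hasDerivAt_norm_sq_of_free_comm dx_free hw.hasDerivAt_snd)).congr_deriv ?_
  rw [← mul_add, re_inner_forcing_add_forcing]

theorem exists_hasDerivAt_toHNeg1L_mul_star {u : ℝ → H1} {u' : HNeg1}
    (hu : HasDerivAt (fun s => toHNeg1L (u s)) u' t) (hcont : ContinuousAt u t) :
    ∃ ρ' : HNeg1, HasDerivAt (fun s => toHNeg1L (u s * star (u s))) ρ' t ∧
      ∀ p, star p = p → (ρ' p).re = 2 * (u' (star (u t) * p)).re := by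
  refine ⟨_, hasDerivAt_toHNeg1L_mul hu (hasDerivAt_toHNeg1L_star hu) hcont.star,
    fun p hp => ?_⟩
  rw [add_apply, ContinuousLinearMap.comp_apply, ContinuousLinearMap.comp_apply, conjDual_apply,
    ← H1.mul_def, ← H1.mul_def, star_mul', hp, Complex.add_re, Complex.star_def, Complex.conj_re,
    two_mul]

theorem hasDerivAt_quartic (g₁₁ g₂₂ g₁₂ : ℝ) {u' v' : HNeg1}
    (hu : HasDerivAt (fun s => toHNeg1L (w s).1) u' t)
    (hv : HasDerivAt (fun s => toHNeg1L (w s).2) v' t) (hcont : ContinuousAt w t) :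
    HasDerivAt (fun s => quartic g₁₁ g₂₂ g₁₂ (w s))
      (2 * (u' (star (w t).1 * potential g₁₁ g₁₂ (w t).1 (w t).2)).re
        + 2 * (v' (star (w t).2 * potential g₂₂ g₁₂ (w t).2 (w t).1)).re) t := by
  obtain ⟨ρ', hρ, hρ'⟩ := exists_hasDerivAt_toHNeg1L_mul_star hu hcont.fst
  obtain ⟨σ', hσ, hσ'⟩ := exists_hasDerivAt_toHNeg1L_mul_star hv hcont.snd
  have hρcont := hcont.fst.mul hcont.fst.star
  have hσcont := hcont.snd.mul hcont.snd.star
  have hre {c : ℝ → ℂ} {c' : ℂ} (h : HasDerivAt c c' t) : HasDerivAt (fun s => (c s).re) c'.re t :=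
    Complex.reCLM.hasFDerivAt.comp_hasDerivAt t h
  have h₁₁ := hre (hasDerivAt_toHNeg1L_apply hρ hρ hρcont)
  have h₂₂ := hre (hasDerivAt_toHNeg1L_apply hσ hσ hσcont)
  have h₁₂ := hre (hasDerivAt_toHNeg1L_apply hρ hσ hσcont)
  rw [← hρ' _ (star_potential _ _ _ _), ← hσ' _ (star_potential _ _ _ _)]
  refine (((h₁₁.const_mul (g₁₁ / 2)).add (h₂₂.const_mul (g₂₂ / 2))).add
    (h₁₂.const_mul g₁₂)).congr_deriv ?_
  simp only [potential, map_add, map_smul, smul_eq_mul, Complex.add_re, Complex.re_ofReal_mul]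
  ring

theorem IsMildSolutionAt.continuousAt (hw : IsMildSolutionAt κ γ g₁₁ g₂₂ g₁₂ w t) :
    ContinuousAt w t :=
  (continuousAt_of_free_neg hw.hasDerivAt_fst.continuousAt).prodMk
    (continuousAt_of_free_neg hw.hasDerivAt_snd.continuousAt)

theorem hasDerivAt_hamiltonian (hw : IsMildSolutionAt κ γ g₁₁ g₂₂ g₁₂ w t) :
    HasDerivAt (fun s => hamiltonian g₁₁ g₂₂ g₁₂ (w s))
      (2 * (γ * (‖dx (w t).1‖ ^ 2 - ‖dx (w t).2‖ ^ 2)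
        - (toHNeg1L (forcing κ γ g₁₁ g₁₂ (w t).1 (w t).2)
            (star (w t).1 * potential g₁₁ g₁₂ (w t).1 (w t).2)).re
        - (toHNeg1L (forcing κ (-γ) g₂₂ g₁₂ (w t).2 (w t).1)
            (star (w t).2 * potential g₂₂ g₁₂ (w t).2 (w t).1)).re)) t := by
  refine ((hasDerivAt_kinetic hw).sub (hasDerivAt_quartic g₁₁ g₂₂ g₁₂
    (hasDerivAt_toHNeg1L hw.hasDerivAt_fst) (hasDerivAt_toHNeg1L hw.hasDerivAt_snd)
    hw.continuousAt)).congr_deriv ?_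
  rw [add_apply, add_apply, Complex.add_re, Complex.add_re, re_schrodingerOp_star_mul_potential,
    re_schrodingerOp_star_mul_potential]
  ring

/-- The exponential rate at which the energy can grow. -/
def growthRate (κ γ g₁₁ g₂₂ g₁₂ : ℝ) : ℝ :=
  4 * |γ| + 8 * (|κ| + |γ|) * coupling g₁₁ g₂₂ g₁₂
    + 6 * |γ| * (2 * coupling g₁₁ g₂₂ g₁₂ ^ 2 + 1)

theorem growthRate_nonneg (κ γ g₁₁ g₂₂ g₁₂ : ℝ) : 0 ≤ growthRate κ γ g₁₁ g₂₂ g₁₂ := by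
  have := coupling_nonneg g₁₁ g₂₂ g₁₂
  unfold growthRate
  positivity

theorem abs_mul_sub_le (γ : ℝ) {a b : ℝ} (ha : 0 ≤ a) (hb : 0 ≤ b) :
    |γ * (a - b)| ≤ |γ| * (a + b) := by
  rw [abs_mul]
  gcongr
  exact abs_le.2 ⟨by linarith, by linarith⟩

theorem exists_hasDerivAt_mass_abs_le (hw : IsMildSolutionAt κ γ g₁₁ g₂₂ g₁₂ w t) :
    ∃ m', HasDerivAt (fun s => mass (w s)) m' t ∧ |m'| ≤ 2 * |γ| * mass (w t) := by
  refine ⟨_, hasDerivAt_mass hw, ?_⟩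
  rw [mul_assoc, abs_mul, abs_two, mul_assoc]
  gcongr
  exact abs_mul_sub_le γ (sq_nonneg _) (sq_nonneg _)

theorem exists_hasDerivAt_hamiltonian_abs_le (hw : IsMildSolutionAt κ γ g₁₁ g₂₂ g₁₂ w t) :
    ∃ h', HasDerivAt (fun s => hamiltonian g₁₁ g₂₂ g₁₂ (w s)) h' t ∧
      |h'| ≤ 2 * |γ| * kinetic (w t)
        + 4 * (|κ| + |γ|) * coupling g₁₁ g₂₂ g₁₂ * quarticBound (w t) := by
  refine ⟨_, hasDerivAt_hamiltonian hw, ?_⟩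
  have hu := norm_toL2_fst_le_sqrt_mass (w t)
  have hv := norm_toL2_snd_le_sqrt_mass (w t)
  have hu' := norm_dx_fst_le_sqrt_kinetic (w t)
  have hv' := norm_dx_snd_le_sqrt_kinetic (w t)
  have hγ := abs_mul_sub_le γ (sq_nonneg ‖dx (w t).1‖) (sq_nonneg ‖dx (w t).2‖)
  have hfst := abs_re_toHNeg1L_forcing_le (κ := κ) (γ := γ) (a := g₁₁) (b := g₁₂) hu hu' hv hv'
  have hsnd := abs_re_toHNeg1L_forcing_le (κ := κ) (γ := -γ) (a := g₂₂) (b := g₁₂) hv hv' hu hu'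
  rw [← kinetic] at hγ
  rw [← quarticBound] at hfst hsnd
  rw [abs_neg] at hsnd
  have hQ : 0 ≤ (|κ| + |γ|) * (|g₁₁| + |g₂₂|) * quarticBound (w t) :=
    mul_nonneg (by positivity) (quarticBound_nonneg _)
  have habs (x y z : ℝ) : |x - y - z| ≤ |x| + |y| + |z| :=
    (abs_sub _ _).trans (by gcongr; exact abs_sub _ _)
  rw [abs_mul, abs_two, coupling]
  linarith [habs (γ * (‖dx (w t).1‖ ^ 2 - ‖dx (w t).2‖ ^ 2))
    (toHNeg1L (forcing κ γ g₁₁ g₁₂ (w t).1 (w t).2)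
      (star (w t).1 * potential g₁₁ g₁₂ (w t).1 (w t).2)).re
    (toHNeg1L (forcing κ (-γ) g₂₂ g₁₂ (w t).2 (w t).1)
      (star (w t).2 * potential g₂₂ g₁₂ (w t).2 (w t).1)).re]

theorem exists_hasDerivAt_energy_abs_le (hw : IsMildSolutionAt κ γ g₁₁ g₂₂ g₁₂ w t) :
    ∃ e', HasDerivAt (fun s => energy g₁₁ g₂₂ g₁₂ (w s)) e' t ∧
      |e'| ≤ growthRate κ γ g₁₁ g₂₂ g₁₂ * energy g₁₁ g₂₂ g₁₂ (w t) := by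
  obtain ⟨m', hm, hm'⟩ := exists_hasDerivAt_mass_abs_le hw
  obtain ⟨h', hh, hh'⟩ := exists_hasDerivAt_hamiltonian_abs_le hw
  set c := 2 * coupling g₁₁ g₂₂ g₁₂ ^ 2 + 1
  refine ⟨_, (hh.add hm).add ((hm.pow 3).const_mul c), ?_⟩
  have hmass := mass_nonneg (w t)
  have hkinetic := kinetic_nonneg (w t)
  have hcubic : |c * (3 * mass (w t) ^ 2 * m')| ≤ 6 * |γ| * c * mass (w t) ^ 3 := by
    rw [abs_mul, abs_mul, abs_of_nonneg (by positivity : 0 ≤ c),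
      abs_of_nonneg (by positivity : 0 ≤ 3 * mass (w t) ^ 2)]
    calc c * (3 * mass (w t) ^ 2 * |m'|)
        ≤ c * (3 * mass (w t) ^ 2 * (2 * |γ| * mass (w t))) := by gcongr
      _ = 6 * |γ| * c * mass (w t) ^ 3 := by ring
  have hcoercive := add_le_energy (g₁₁ := g₁₁) (g₂₂ := g₂₂) (g₁₂ := g₁₂) (w t)
  have hgrowth : 2 * |γ| * kinetic (w t)
      + 4 * (|κ| + |γ|) * coupling g₁₁ g₂₂ g₁₂ * quarticBound (w t) + 2 * |γ| * mass (w t)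
      + 6 * |γ| * c * mass (w t) ^ 3 ≤ growthRate κ γ g₁₁ g₂₂ g₁₂ * energy g₁₁ g₂₂ g₁₂ (w t) := by
    have hcoupling := coupling_nonneg g₁₁ g₂₂ g₁₂
    calc _ = 4 * |γ| * (kinetic (w t) / 2 + mass (w t) / 2)
          + 4 * (|κ| + |γ|) * coupling g₁₁ g₂₂ g₁₂ * quarticBound (w t)
          + 6 * |γ| * c * mass (w t) ^ 3 := by ring
      _ ≤ 4 * |γ| * energy g₁₁ g₂₂ g₁₂ (w t)
          + 4 * (|κ| + |γ|) * coupling g₁₁ g₂₂ g₁₂ * (2 * energy g₁₁ g₂₂ g₁₂ (w t))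
          + 6 * |γ| * c * energy g₁₁ g₂₂ g₁₂ (w t) := by
        gcongr
        · linarith [pow_nonneg hmass 3]
        · exact quarticBound_le_two_mul_energy _
        · linarith
      _ = _ := by rw [growthRate]; ring
  refine ((abs_add_three _ _ _).trans ?_).trans hgrowth
  norm_num only [Nat.cast_ofNat]
  linarith

end Derivatives

theorem norm_le_of_isMildSolutionAt {κ γ g₁₁ g₂₂ g₁₂ T : ℝ} {w : ℝ → H1 × H1}
    (hw : ∀ t ∈ Ioo (-T) T, IsMildSolutionAt κ γ g₁₁ g₂₂ g₁₂ w t) {t : ℝ} (ht : t ∈ Ioo (-T) T) :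
    ‖w t‖ ≤ √(2 * energy g₁₁ g₂₂ g₁₂ (w 0)) * exp (growthRate κ γ g₁₁ g₂₂ g₁₂ / 2 * |t|) := by
  choose! e' he' hle using fun t ht => exists_hasDerivAt_energy_abs_le (hw t ht)
  have henergy := norm_le_mul_exp_of_norm_deriv_le he'
    (fun t ht => (hle t ht).trans_eq (by rw [norm_of_nonneg (energy_nonneg _)])) ht
  rw [norm_of_nonneg (energy_nonneg _), norm_of_nonneg (energy_nonneg _)] at henergy
  have hexp : exp (growthRate κ γ g₁₁ g₂₂ g₁₂ * |t|)
      = exp (growthRate κ γ g₁₁ g₂₂ g₁₂ / 2 * |t|) ^ 2 := by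
    rw [← exp_nat_mul]
    ring_nf
  refine (pow_le_pow_iff_left₀ (norm_nonneg _) (by positivity) two_ne_zero).1 ?_
  calc ‖w t‖ ^ 2 ≤ 2 * energy g₁₁ g₂₂ g₁₂ (w t) := norm_sq_le_two_mul_energy _
    _ ≤ 2 * (energy g₁₁ g₂₂ g₁₂ (w 0) * exp (growthRate κ γ g₁₁ g₂₂ g₁₂ * |t|)) := by gcongr
    _ = _ := by
        rw [hexp, mul_pow, sq_sqrt (mul_nonneg zero_le_two (energy_nonneg _)), mul_assoc]

theorem norm_le_of_hasDerivAt_interactionField {κ γ g₁₁ g₂₂ g₁₂ T : ℝ} {z : ℝ → H1 × H1}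
    (hz : ∀ t ∈ Ioo (-T) T, HasDerivAt z (interactionField κ γ g₁₁ g₂₂ g₁₂ t (z t)) t) {t : ℝ}
    (ht : t ∈ Ioo (-T) T) :
    ‖z t‖ ≤ √(2 * energy g₁₁ g₂₂ g₁₂ (z 0)) * exp (growthRate κ γ g₁₁ g₂₂ g₁₂ / 2 * |t|) := by
  simpa only [norm_freePair, freePair_zero] using
    norm_le_of_isMildSolutionAt (fun s hs => isMildSolutionAt_freePair_iff.2 (hz s hs)) ht

theorem exists_isGlobalSolution (κ γ g₁₁ g₂₂ g₁₂ : ℝ) (w₀ : H1 × H1) :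
    ∃ w : C(ℝ, H1 × H1), IsGlobalSolution κ γ g₁₁ g₂₂ g₁₂ w ∧ w 0 = w₀ := by
  have hbound (T : ℝ) : ∃ B, ∀ S ≤ T, ∀ z : ℝ → H1 × H1, z 0 = w₀ →
      (∀ t ∈ Ioo (-S) S, HasDerivAt z (interactionField κ γ g₁₁ g₂₂ g₁₂ t (z t)) t) →
      ∀ t ∈ Ioo (-S) S, ‖z t‖ ≤ B := by
    refine ⟨√(2 * energy g₁₁ g₂₂ g₁₂ w₀) * exp (growthRate κ γ g₁₁ g₂₂ g₁₂ / 2 * T),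
      fun S hST z hz0 hz t ht => (norm_le_of_hasDerivAt_interactionField hz ht).trans ?_⟩
    have hrate := growthRate_nonneg κ γ g₁₁ g₂₂ g₁₂
    rw [hz0]
    gcongr
    exact (abs_lt.2 ht).le.trans hST
  obtain ⟨z, hz0, hz⟩ := exists_forall_hasDerivAt
    (exists_lipschitzOnWith_interactionField κ γ g₁₁ g₂₂ g₁₂)
    (continuous_interactionField κ γ g₁₁ g₂₂ g₁₂) hbound
  have hw (t : ℝ) : IsMildSolutionAt κ γ g₁₁ g₂₂ g₁₂ (fun s => freePair s (z s)) t :=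
    isMildSolutionAt_freePair_iff.2 (hz t)
  have hcont : Continuous fun t => freePair t (z t) :=
    continuous_iff_continuousAt.2 fun t => (hw t).continuousAt
  exact ⟨⟨_, hcont⟩, isGlobalSolution_iff_isMildSolutionAt.2 hw, (freePair_zero _).trans hz0⟩

end PTNLS

end

theorem theorem1_general (κ γ g₁₁ g₂₂ g₁₂ : ℝ) :
    (∀ u₀ v₀ : PTNLS.H1, ∃! w : C(ℝ, PTNLS.H1 × PTNLS.H1),
      PTNLS.IsGlobalSolution κ γ g₁₁ g₂₂ g₁₂ w ∧ w 0 = (u₀, v₀)) ∧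
    (∃ a : ℝ, 0 ≤ a ∧ ∀ w : C(ℝ, PTNLS.H1 × PTNLS.H1),
      PTNLS.IsGlobalSolution κ γ g₁₁ g₂₂ g₁₂ w →
      ∃ C : ℝ, ∀ t : ℝ, ‖(w t).1‖ + ‖(w t).2‖ ≤ C * Real.exp (a * |t|)) := by
  refine ⟨fun u₀ v₀ => ?_, PTNLS.growthRate κ γ g₁₁ g₂₂ g₁₂ / 2,
    div_nonneg (PTNLS.growthRate_nonneg _ _ _ _ _) zero_le_two,
    fun w hw => ⟨2 * √(2 * PTNLS.energy g₁₁ g₂₂ g₁₂ (w 0)), fun t => ?_⟩⟩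
  · obtain ⟨w, hw, hw0⟩ := PTNLS.exists_isGlobalSolution κ γ g₁₁ g₂₂ g₁₂ (u₀, v₀)
    exact ⟨w, ⟨hw, hw0⟩, fun w' hw' => hw'.1.eq_of_apply_zero_eq hw (hw'.2.trans hw0.symm)⟩
  · have hbound := PTNLS.norm_le_of_isMildSolutionAt (T := |t| + 1)
      (fun s _ => PTNLS.isGlobalSolution_iff_isMildSolutionAt.1 hw s) (abs_lt.1 (lt_add_one |t|))
    rw [mul_assoc, two_mul]
    exact add_le_add ((norm_fst_le _).trans hbound) ((norm_snd_le _).trans hbound)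

theorem theorem1 (κ γ g₁₁ g₂₂ g₁₂ : ℝ) (hκ : 0 ≤ κ) (hγ : 0 ≤ γ) :
    (∀ u₀ v₀ : PTNLS.H1, ∃! w : C(ℝ, PTNLS.H1 × PTNLS.H1),
      PTNLS.IsGlobalSolution κ γ g₁₁ g₂₂ g₁₂ w ∧ w 0 = (u₀, v₀)) ∧
    (∃ a : ℝ, 0 ≤ a ∧ ∀ w : C(ℝ, PTNLS.H1 × PTNLS.H1),
      PTNLS.IsGlobalSolution κ γ g₁₁ g₂₂ g₁₂ w →
      ∃ C : ℝ, ∀ t : ℝ, ‖(w t).1‖ + ‖(w t).2‖ ≤ C * Real.exp (a * |t|)) :=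
  theorem1_general κ γ g₁₁ g₂₂ g₁₂
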